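/- Let $0<\alpha\le 2$ and $|\theta|\le\min(1,2/\alpha-1)$, and let $G(x,\alpha,\theta)$ be the distribution function of the standard strictly stable law, i.e. of the probability measure on $\mathbb{R}$ with characteristic function $$\hat g(t,\alpha,\theta)=\exp\left\{-|t|^{\alpha}\exp\left\{-i\tfrac{\pi}{2}\alpha\theta\,\mathrm{sign}\,t\right\}\right\},\qquad t\in\mathbb{R}.$$ For $x\ne0$ put $\theta^*=\theta\,\mathrm{sign}(x)$ and consider the tail series $$\sum_{n=1}^{\infty}\frac{(-1)^{n+1}}{n!}\Gamma(\alpha n)\sin\left(\tfrac{\pi}{2}\alpha n(1+\theta^*)\right)|x|^{-\alpha n}.\tag{$*$}$$ 1. If $\alpha<1$, then for every $x\neq 0$ the series $(*)$ converges and $$G(x,\alpha,\theta)=\tfrac12(1+\mathrm{sign}(x))-\frac{\mathrm{sign}(x)}{\pi}\sum_{n=1}^{\infty}\frac{(-1)^{n+1}}{n!}\Gamma(\alpha n)\sin\left(\tfrac{\pi}{2}\alpha n(1+\theta^*)\right)|x|^{-\alpha n}.$$ 2. If $\alpha=1$, then for every $x$ with $|x|>1$ the series $(*)$ converges and $$G(x,1,\theta)=\tfrac12(1+\mathrm{sign}(x))-\frac{\mathrm{sign}(x)}{\pi}\sum_{n=1}^{\infty}\frac{(-1)^{n+1}}{n}\sin\left(\tfrac{\pi}{2}n(1+\theta^*)\right)|x|^{-n}.$$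 3. If $\alpha>1$, then for every $x\ne0$ the series $(*)$ diverges, unless $\theta^*=2/\alpha-1$ (in that case all terms of $(*)$ are zero, because $\sin(\tfrac{\pi}{2}\alpha n(1+\theta^*))=\sin(\pi n)=0$). In all cases with $\alpha>1$ the partial sums give an asymptotic expansion of $G$: for every fixed integer $N\ge1$, $$G(x,\alpha,\theta)=\tfrac12(1+\mathrm{sign}(x))-\frac{\mathrm{sign}(x)}{\pi}\sum_{n=1}^{N-1}\frac{(-1)^{n+1}}{n!}\Gamma(\alpha n)\sin\left(\tfrac{\pi}{2}\alpha n(1+\theta^*)\right)|x|^{-\alpha n}+O\left(|x|^{-\alpha N}\right)$$ as $x\to+\infty$ and as $x\to-\infty$. -/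

import Mathlib

open MeasureTheory Filter Asymptotics
open scoped Topology Nat

namespace StrictlyStable

/-- The parameters `(α, θ)` are admissible: `α ∈ (0, 2]` and `|θ| ≤ min (1, 2 / α - 1)`. -/
structure Admissible (α θ : ℝ) : Prop where
  pos : 0 < α
  le_two : α ≤ 2
  abs_le : |θ| ≤ min 1 (2 / α - 1)

/-- The characteristic function of the standard strictly stable law,
`exp (-|t|^α exp (-i (π/2) α θ sign t))`. -/
noncomputable def stableCharFun (α θ t : ℝ) : ℂ :=
  Complex.exp (-((|t| ^ α : ℝ) : ℂ) *
    Complex.exp (-Complex.I * ((Real.pi / 2 * α * θ * Real.sign t : ℝ) : ℂ)))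

/-- `μ` is the standard strictly stable law with parameters `(α, θ)`: the probability measure
on the line with characteristic function `stableCharFun α θ`.  Its distribution function
`G(x, α, θ)` is `ProbabilityTheory.cdf μ x`. -/
structure IsStandardStrictlyStable (α θ : ℝ) (μ : Measure ℝ) : Prop where
  isProbabilityMeasure : IsProbabilityMeasure μ
  charFun_eq : ∀ t : ℝ, charFun μ t = stableCharFun α θ t

/-- The `n`-th term of the tail series (without the factor `1 / π`). It is used for `0 < x` and
`1 ≤ n` only. -/
noncomputable def tailTerm (x α θ : ℝ) (n : ℕ) : ℝ :=
  (-1) ^ (n + 1) / (n ! : ℝ) * Real.Gamma (α * n) *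
    Real.sin (Real.pi / 2 * α * n * (1 + θ)) * x ^ (-(α * n))

/-- The partial sum `(1 / π) ∑_{n = 1}^{N - 1}` of the tail series. -/
noncomputable def tailPartialSum (N : ℕ) (x α θ : ℝ) : ℝ :=
  1 / Real.pi * ∑ n ∈ Finset.Ico 1 N, tailTerm x α θ n

/-- `θ* = θ sign x`. -/
noncomputable def thetaStar (θ x : ℝ) : ℝ := θ * Real.sign x

end StrictlyStable

/-! Write `c = exp (-i π α θ / 2)`. When `|α θ| < 1` we have `Re c > 0`, so the characteristic
function is integrable and the law has a continuous density `p`. Conjugate symmetry folds the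
inversion integral onto the half-line: `π p(x) = Re L(i x)`, where `L(z) = ∫₀^∞ exp (-z t) exp (-c
t^α) dt` is `stretchedLaplace`. Expanding `exp (-c t^α)` and applying Euler's integral termwise
gives the series `laplaceTerm` in `z^(-α n - 1)`. Its real part on the imaginary axis is
`densityTerm`, and integration over `(y, ∞)` turns that into `tailTerm`.

The three regimes differ in how this formal expansion is justified. For `α < 1` the coefficients
`Γ(α n + 1) / n!` make the series converge absolutely in `Re z > 0`, and dominated convergence
reaches `z = i x` (`hasSum_stretchedLaplace`). For `α = 1` it is a geometric series. For `1 < α` the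
path of integration is first rotated (`stretchedLaplace_rotate`), so that `i x` becomes a point with
positive real part; the Taylor remainder of `exp` then bounds the error
(`exists_norm_stretchedLaplace_sub_le`). Divergence holds because `Γ(α n) r^n / n!` stays away from
zero while `sin (π β n)` does not tend to zero for `0 < β < 1`.

Left tails are right tails of the reflected law, which has parameter `-θ`. Admissibility forces `|α
θ| < 1` except when `α = 1` and `|θ| = 1`; there the law is a point mass at `θ` and is treated
directly. -/

namespace StrictlyStable

/-! ### Fourier inversion for finite measures -/

open scoped FourierTransform SchwartzMap in
/-- Parseval's relation between a finite measure and its integrable characteristic function. -/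
lemma integral_schwartz_eq (μ : Measure ℝ) [IsFiniteMeasure μ]
    (hφ : Integrable (fun v : ℝ => charFun μ (2 * Real.pi * v))) (f : 𝓢(ℝ, ℂ)) :
    ∫ x, f x ∂μ = ∫ x, f x * 𝓕 (fun v : ℝ => charFun μ (2 * Real.pi * v)) x := by
  have h1 : ∫ x, f x * 𝓕 (fun v : ℝ => charFun μ (2 * Real.pi * v)) x =
      ∫ v, 𝓕 (f : ℝ → ℂ) v * charFun μ (2 * Real.pi * v) := by
    have := VectorFourier.integral_fourierIntegral_smul_eq_flip (L := innerₗ ℝ)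
      (μ := volume) (ν := volume) Real.continuous_fourierChar continuous_inner f.integrable hφ
    rw [flip_innerₗ] at this
    exact this.symm
  have h2 : ∀ x, f x = ∫ v, 𝓕 (f : ℝ → ℂ) v * Complex.exp ((2 * Real.pi * v * x : ℝ) * Complex.I) := by
    intro x
    have e1 : 𝓕⁻ (𝓕 (f : ℝ → ℂ)) = f :=
      Continuous.fourierInv_fourier_eq f.continuous f.integrable (by
        rw [← SchwartzMap.fourier_coe]; exact (𝓕 f).integrable)
    conv_lhs => rw [← e1]
    rw [Real.fourierInv_eq']
    congr 1; ext v
    simp only [smul_eq_mul, RCLike.inner_apply, conj_trivial]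
    rw [mul_comm]
    congr 3
    push_cast; ring
  rw [h1]
  simp_rw [charFun_apply_real]
  simp_rw [← integral_const_mul]
  rw [integral_integral_swap]
  · refine integral_congr_ae (Eventually.of_forall fun x => ?_)
    simp only
    rw [h2 x]
    congr 1; ext v; congr 2; push_cast; ring
  · have hF : Integrable (𝓕 (f : ℝ → ℂ)) := by
      rw [← SchwartzMap.fourier_coe]; exact (𝓕 f).integrable
    have := (hF.mul_prod (integrable_const (1:ℂ) : Integrable (fun _ : ℝ => (1:ℂ)) μ))
    refine this.mono ?_ (Eventually.of_forall fun z => ?_)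
    · have : AEStronglyMeasurable (fun z : ℝ × ℝ => 𝓕 (f : ℝ → ℂ) z.1 * 1) (volume.prod μ) := this.1
      simp only [mul_one] at this
      exact this.mul (by fun_prop)
    · simp only [Function.uncurry, norm_mul, mul_one]
      have : ‖Complex.exp (((2 * Real.pi * z.1 : ℝ):ℂ) * z.2 * Complex.I)‖ = 1 := by
        rw [← Complex.ofReal_mul, Complex.norm_exp_ofReal_mul_I]
      push_cast at this ⊢
      rw [this, mul_one]

/-- A smooth approximation of the indicator of `(a, b)`, depending on `n`. -/
noncomputable def smoothBump (a b : ℝ) (n : ℕ) (x : ℝ) : ℝ :=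
  Real.smoothTransition (n * (x - a)) * Real.smoothTransition (n * (b - x))

lemma smoothBump_eq_zero {a b x : ℝ} (n : ℕ) (hx : x ∉ Set.Ioo a b) : smoothBump a b n x = 0 := by
  unfold smoothBump
  by_cases h : a < x
  · have : b ≤ x := by by_contra h'; exact hx ⟨h, not_le.1 h'⟩
    rw [Real.smoothTransition.zero_of_nonpos (x := n * (b - x)), mul_zero]
    exact mul_nonpos_of_nonneg_of_nonpos (by positivity) (by linarith)
  · rw [Real.smoothTransition.zero_of_nonpos (x := n * (x - a)), zero_mul]
    exact mul_nonpos_of_nonneg_of_nonpos (by positivity) (by linarith)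

lemma abs_smoothBump_le (a b : ℝ) (n : ℕ) (x : ℝ) : |smoothBump a b n x| ≤ 1 := by
  unfold smoothBump
  rw [abs_of_nonneg (mul_nonneg (Real.smoothTransition.nonneg _) (Real.smoothTransition.nonneg _))]
  exact mul_le_one₀ (Real.smoothTransition.le_one _) (Real.smoothTransition.nonneg _)
    (Real.smoothTransition.le_one _)

lemma tendsto_smoothBump (a b x : ℝ) :
    Tendsto (fun n => smoothBump a b n x) atTop (𝓝 ((Set.Ioo a b).indicator (fun _ => 1) x)) := by
  by_cases hx : x ∈ Set.Ioo a b
  · rw [Set.indicator_of_mem hx]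
    have key : ∀ δ : ℝ, 0 < δ → ∀ᶠ n : ℕ in atTop, 1 ≤ n * δ := fun δ hδ =>
      (tendsto_natCast_atTop_atTop.atTop_mul_const hδ).eventually_ge_atTop 1
    refine tendsto_const_nhds.congr' ?_
    filter_upwards [key _ (sub_pos.2 hx.1), key _ (sub_pos.2 hx.2)] with n h1 h2
    rw [smoothBump, Real.smoothTransition.one_of_one_le h1, Real.smoothTransition.one_of_one_le h2,
      one_mul]
  · rw [Set.indicator_of_notMem hx]
    simp only [smoothBump_eq_zero _ hx]
    exact tendsto_const_nhds

lemma contDiff_smoothBump (a b : ℝ) (n : ℕ) :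
    ContDiff ℝ (⊤ : ℕ∞) (fun x => (smoothBump a b n x : ℂ)) := by
  have h : ContDiff ℝ (⊤ : ℕ∞) (smoothBump a b n) :=
    (Real.smoothTransition.contDiff.comp (by fun_prop : ContDiff ℝ _ fun x : ℝ => n * (x - a))).mul
      (Real.smoothTransition.contDiff.comp (by fun_prop : ContDiff ℝ _ fun x : ℝ => n * (b - x)))
  exact Complex.ofRealCLM.contDiff.comp h

lemma hasCompactSupport_smoothBump (a b : ℝ) (n : ℕ) :
    HasCompactSupport (fun x => (smoothBump a b n x : ℂ)) := by
  refine HasCompactSupport.of_support_subset_isCompact (isCompact_Icc (a := a) (b := b)) ?_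
  intro x hx
  by_contra h
  apply hx
  simp [smoothBump_eq_zero n (fun h' => h (Set.Ioo_subset_Icc_self h'))]

open scoped FourierTransform in
/-- Inversion formula for a measure with an integrable characteristic function. -/
lemma measureReal_Ioo_eq (μ : Measure ℝ) [IsFiniteMeasure μ]
    (hφ : Integrable (fun v : ℝ => charFun μ (2 * Real.pi * v))) (a b : ℝ) :
    (μ.real (Set.Ioo a b) : ℂ) =
      ∫ x in Set.Ioo a b, 𝓕 (fun v : ℝ => charFun μ (2 * Real.pi * v)) x := by
  set q := 𝓕 (fun v : ℝ => charFun μ (2 * Real.pi * v)) with hq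
  have hqc : Continuous q := by
    exact VectorFourier.fourierIntegral_continuous Real.continuous_fourierChar
      continuous_inner hφ
  have hI : ∀ n, ∫ x, (smoothBump a b n x : ℂ) ∂μ = ∫ x, (smoothBump a b n x : ℂ) * q x := fun n =>
    integral_schwartz_eq μ hφ
      ((hasCompactSupport_smoothBump a b n).toSchwartzMap (contDiff_smoothBump a b n))
  have hlim : ∀ x, Tendsto (fun n => (smoothBump a b n x : ℂ)) atTop
      (𝓝 ((Set.Ioo a b).indicator (fun _ => 1) x)) := by
    intro x
    have := (Complex.continuous_ofReal.tendsto _).comp (tendsto_smoothBump a b x)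
    rwa [show ((Set.Ioo a b).indicator (fun _ => (1 : ℂ)) x) =
      (((Set.Ioo a b).indicator (fun _ => (1 : ℝ)) x : ℝ) : ℂ) by
        by_cases hx : x ∈ Set.Ioo a b <;> simp [hx]]
  have h1 : Tendsto (fun n => ∫ x, (smoothBump a b n x : ℂ) ∂μ) atTop
      (𝓝 (∫ x, (Set.Ioo a b).indicator (fun _ => (1:ℂ)) x ∂μ)) := by
    refine tendsto_integral_of_dominated_convergence (fun _ => 1)
      (fun n => (contDiff_smoothBump a b n).continuous.aestronglyMeasurable)
      (integrable_const _) (fun n => Eventually.of_forall fun x => ?_)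
      (Eventually.of_forall hlim)
    simpa using abs_smoothBump_le a b n x
  have h2 : Tendsto (fun n => ∫ x, (smoothBump a b n x : ℂ) * q x) atTop
      (𝓝 (∫ x, (Set.Ioo a b).indicator (fun _ => (1:ℂ)) x * q x)) := by
    -- The bumps approximate the indicator from inside, so `‖q‖` restricted to the bounded interval
    -- dominates; no integrability of `q` on the line is needed.
    refine tendsto_integral_of_dominated_convergence ((Set.Ioo a b).indicator (fun x => ‖q x‖))
      (fun n => ((contDiff_smoothBump a b n).continuous.mul hqc).aestronglyMeasurable)
      ?_ (fun n => Eventually.of_forall fun x => ?_)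
      (Eventually.of_forall fun x => (hlim x).mul_const _)
    · rw [integrable_indicator_iff measurableSet_Ioo]
      exact (hqc.norm.integrableOn_Icc).mono_set Set.Ioo_subset_Icc_self
    · by_cases hx : x ∈ Set.Ioo a b
      · rw [Set.indicator_of_mem hx, norm_mul, Complex.norm_real]
        exact mul_le_of_le_one_left (norm_nonneg _) (abs_smoothBump_le a b n x)
      · simp [Set.indicator_of_notMem hx, smoothBump_eq_zero n hx]
  have h3 := tendsto_nhds_unique (h1.congr hI) h2
  rw [integral_indicator measurableSet_Ioo] at h3
  simp only [integral_const, MeasurableSet.univ, measureReal_restrict_apply, Set.univ_inter] at h3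
  rw [show (μ.real (Set.Ioo a b) : ℂ) = μ.real (Set.Ioo a b) • (1:ℂ) by simp, h3,
    ← integral_indicator measurableSet_Ioo]
  congr 1; ext x
  by_cases hx : x ∈ Set.Ioo a b <;> simp [hx]

/-! ### Growth of Gamma quotients and divergence of the series -/

/-- Log-convexity of Gamma, with `x + a` between `x` and `x + 1`. -/
lemma gamma_add_le {a x : ℝ} (ha : 0 < a) (ha1 : a < 1) (hx : 0 < x) :
    Real.Gamma (x + a) ≤ x ^ a * Real.Gamma x := by
  have h := Real.Gamma_mul_add_mul_le_rpow_Gamma_mul_rpow_Gamma (s := x) (t := x + 1) (a := 1 - a)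
    (b := a) hx (by linarith) (by linarith) ha (by ring)
  have hG := Real.Gamma_pos_of_pos hx
  rw [show (1 - a) * x + a * (x + 1) = x + a by ring, Real.Gamma_add_one hx.ne',
    Real.mul_rpow hx.le hG.le, mul_left_comm, ← Real.rpow_add hG] at h
  simpa using h

/-- Log-convexity again, now with `x + 1` between `x` and `x + a`; the inequality is then raised to
the power `a`. -/
lemma rpow_mul_gamma_le {a x : ℝ} (ha : 1 < a) (hx : 0 < x) :
    x ^ a * Real.Gamma x ≤ Real.Gamma (x + a) := by
  have ha0 : 0 < a := by linarith
  have hG := Real.Gamma_pos_of_pos hx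
  have hG' := Real.Gamma_pos_of_pos (add_pos hx ha0)
  have h := Real.Gamma_mul_add_mul_le_rpow_Gamma_mul_rpow_Gamma (s := x) (t := x + a)
    (a := 1 - 1 / a) (b := 1 / a) hx (by linarith)
    (by rw [sub_pos, div_lt_one ha0]; exact ha) (by positivity) (by ring)
  rw [show (1 - 1 / a) * x + 1 / a * (x + a) = x + 1 by field_simp; ring,
    Real.Gamma_add_one hx.ne'] at h
  have h2 := Real.rpow_le_rpow (by positivity) h ha0.le
  rw [Real.mul_rpow hx.le hG.le, Real.mul_rpow (by positivity) (by positivity),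
    ← Real.rpow_mul hG.le, ← Real.rpow_mul hG'.le, one_div_mul_cancel ha0.ne', Real.rpow_one,
    show (1 - 1 / a) * a = a - 1 by field_simp, Real.rpow_sub_one hG.ne'] at h2
  have hp : 0 < Real.Gamma x ^ a := by positivity
  rw [div_mul_eq_mul_div, le_div_iff₀ hG] at h2
  nlinarith

/-- Ratio test: by `gamma_add_le` consecutive terms have ratio at most a constant times `(n + 1)^(a
- 1)`, which tends to zero. -/
lemma summable_gamma_div_factorial {a b r : ℝ} (ha : 0 < a) (ha1 : a < 1) (hb : 0 < b)
    (hr : 0 < r) : Summable fun n : ℕ => Real.Gamma (a * n + b) / (n ! : ℝ) * r ^ n := by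
  refine summable_of_ratio_norm_eventually_le (r := 1 / 2) (by norm_num) ?_
  have hlim : Tendsto (fun n : ℕ => (a + b) ^ a * r * ((n : ℝ) + 1) ^ (-(1 - a))) atTop
      (𝓝 ((a + b) ^ a * r * 0)) :=
    ((tendsto_rpow_neg_atTop (sub_pos.2 ha1)).comp
      (tendsto_atTop_add_const_right _ _ tendsto_natCast_atTop_atTop)).const_mul _
  rw [mul_zero] at hlim
  filter_upwards [hlim.eventually_le_const (show (0 : ℝ) < 1 / 2 by norm_num)] with n hn
  have hx : 0 < a * n + b := by positivity
  have hG := Real.Gamma_pos_of_pos hx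
  have hG1 := Real.Gamma_pos_of_pos (show 0 < a * ((n + 1 : ℕ) : ℝ) + b by positivity)
  rw [Real.norm_of_nonneg (by positivity), Real.norm_of_nonneg (by positivity)]
  have h1 := gamma_add_le ha ha1 hx
  have h2 : (a * n + b) ^ a ≤ (a + b) ^ a * ((n : ℝ) + 1) ^ a := by
    rw [← Real.mul_rpow (by positivity) (by positivity)]
    exact Real.rpow_le_rpow hx.le (by nlinarith [(Nat.cast_nonneg n : (0 : ℝ) ≤ n)]) ha.le
  have hn1 : (0 : ℝ) < (n : ℝ) + 1 := by positivity
  rw [show -(1 - a) = a - 1 by ring, Real.rpow_sub_one hn1.ne'] at hn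
  rw [show a * ((n + 1 : ℕ) : ℝ) + b = a * n + b + a by push_cast; ring, Nat.factorial_succ]
  push_cast
  calc Real.Gamma (a * n + b + a) / ((n + 1) * (n ! : ℝ)) * r ^ (n + 1)
      ≤ ((a + b) ^ a * ((n : ℝ) + 1) ^ a * Real.Gamma (a * n + b)) / ((n + 1) * (n ! : ℝ))
          * r ^ (n + 1) := by gcongr; exact h1.trans (by gcongr)
    _ = ((a + b) ^ a * r * (((n : ℝ) + 1) ^ a / (n + 1))) *
          (Real.Gamma (a * n + b) / (n ! : ℝ) * r ^ n) := by field_simp; ring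
    _ ≤ _ := by gcongr

/-- By `rpow_mul_gamma_le` the ratio of consecutive terms is at least a constant times `n^(a - 1)`,
which tends to infinity. The sequence is therefore eventually nondecreasing, and `δ` is its value
where the ratio bound sets in. -/
lemma eventually_le_gamma_div_factorial {a r : ℝ} (ha : 1 < a) (hr : 0 < r) :
    ∃ δ : ℝ, 0 < δ ∧ ∀ᶠ n : ℕ in atTop, δ ≤ Real.Gamma (a * n) / (n ! : ℝ) * r ^ n := by
  have ha0 : 0 < a := by linarith
  have hlim : Tendsto (fun n : ℕ => a ^ a * r / 2 * (n : ℝ) ^ (a - 1)) atTop atTop :=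
    ((tendsto_rpow_atTop (sub_pos.2 ha)).comp tendsto_natCast_atTop_atTop).const_mul_atTop
      (by positivity)
  obtain ⟨N, hN⟩ := eventually_atTop.1 ((hlim.eventually_ge_atTop 1).and (eventually_ge_atTop 1))
  have hpos : ∀ n : ℕ, 1 ≤ n → 0 < Real.Gamma (a * n) / (n ! : ℝ) * r ^ n := fun n hn => by
    have := Real.Gamma_pos_of_pos (show 0 < a * (n : ℝ) by positivity)
    positivity
  refine ⟨Real.Gamma (a * N) / (N ! : ℝ) * r ^ N, hpos N (hN N le_rfl).2, ?_⟩
  filter_upwards [eventually_ge_atTop N] with n hn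
  induction n, hn using Nat.le_induction with
  | base => exact le_rfl
  | succ n hn ih =>
    refine ih.trans ?_
    obtain ⟨h1, h2⟩ := hN n hn
    have hn0 : (0 : ℝ) < n := by exact_mod_cast h2
    have hx : 0 < a * (n : ℝ) := by positivity
    have hG := Real.Gamma_pos_of_pos hx
    have h3 := rpow_mul_gamma_le ha hx
    rw [Real.mul_rpow ha0.le hn0.le] at h3
    rw [Real.rpow_sub_one hn0.ne'] at h1
    rw [show a * ((n + 1 : ℕ) : ℝ) = a * n + a by push_cast; ring, Nat.factorial_succ]
    push_cast
    have h4 : (n : ℝ) + 1 ≤ 2 * n := by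
      have : (1 : ℝ) ≤ n := by exact_mod_cast h2
      linarith
    calc Real.Gamma (a * n) / (n ! : ℝ) * r ^ n
        ≤ (a ^ a * r / 2 * ((n : ℝ) ^ a / n)) * (Real.Gamma (a * n) / (n ! : ℝ) * r ^ n) :=
          le_mul_of_one_le_left (by positivity) h1
      _ = (a ^ a * (n : ℝ) ^ a * Real.Gamma (a * n)) / (2 * n * (n ! : ℝ)) * r ^ (n + 1) := by
          field_simp; ring
      _ ≤ _ := by gcongr

/-- If the sines tended to zero, the addition formula would make `cos (π β n)` tend to zero as well,
since `sin (π β) ≠ 0`; this contradicts `sin² + cos² = 1`. -/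
lemma not_tendsto_sin_mul_nat {β : ℝ} (h0 : 0 < β) (h1 : β < 1) :
    ¬ Tendsto (fun n : ℕ => Real.sin (Real.pi * β * n)) atTop (𝓝 0) := by
  intro h
  have hs : 0 < Real.sin (Real.pi * β) :=
    Real.sin_pos_of_pos_of_lt_pi (by positivity) (by nlinarith [Real.pi_pos])
  -- The quotient is `cos (π β n)` written through two consecutive sines.
  have hsum : Tendsto (fun n : ℕ => Real.sin (Real.pi * β * n) ^ 2 +
      ((Real.sin (Real.pi * β * (n + 1 : ℕ)) - Real.sin (Real.pi * β * n) * Real.cos (Real.pi * β))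
        / Real.sin (Real.pi * β)) ^ 2) atTop
      (𝓝 (0 ^ 2 + ((0 - 0 * Real.cos (Real.pi * β)) / Real.sin (Real.pi * β)) ^ 2)) :=
    (h.pow 2).add (((((tendsto_add_atTop_iff_nat 1).2 h).sub (h.mul_const _)).div_const _).pow 2)
  have he : ∀ n : ℕ, Real.sin (Real.pi * β * n) ^ 2 +
      ((Real.sin (Real.pi * β * (n + 1 : ℕ)) - Real.sin (Real.pi * β * n) * Real.cos (Real.pi * β))
        / Real.sin (Real.pi * β)) ^ 2 = 1 := fun n => by
    rw [show Real.pi * β * ((n + 1 : ℕ) : ℝ) = Real.pi * β * n + Real.pi * β by push_cast; ring,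
      Real.sin_add, add_sub_cancel_left, mul_div_assoc, div_self hs.ne', mul_one,
      Real.sin_sq_add_cos_sq]
  simp_rw [he] at hsum
  have := tendsto_nhds_unique hsum tendsto_const_nhds
  norm_num at this

/-- Divergence of the tail series for `1 < α` away from the extremal asymmetry. -/
lemma not_tendsto_sum_tailTerm {α θ x : ℝ} (hα : 1 < α) (hx : 0 < x)
    (h0 : 0 < α * (1 + θ) / 2) (h1 : α * (1 + θ) / 2 < 1) :
    ¬ ∃ S : ℝ, Tendsto (fun N : ℕ => ∑ n ∈ Finset.Ico 1 N, tailTerm x α θ n) atTop (𝓝 S) := by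
  rintro ⟨S, hS⟩
  have hterm : Tendsto (fun n : ℕ => tailTerm x α θ n) atTop (𝓝 0) := by
    have h2 := ((tendsto_add_atTop_iff_nat 1).2 hS).sub hS
    rw [sub_self] at h2
    refine h2.congr' ?_
    filter_upwards [eventually_ge_atTop 1] with n hn
    rw [Finset.sum_Ico_succ_top hn, add_sub_cancel_left]
  obtain ⟨δ, hδ, hev⟩ := eventually_le_gamma_div_factorial hα (Real.rpow_pos_of_pos hx (-α))
  refine not_tendsto_sin_mul_nat h0 h1 ?_
  have hb := hterm.norm.div_const δ
  rw [norm_zero, zero_div] at hb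
  -- The Gamma factor is eventually at least `δ`, so the sine is at most `‖tailTerm‖ / δ`.
  refine squeeze_zero_norm' ?_ hb
  filter_upwards [hev] with n hn
  rw [le_div_iff₀ hδ]
  have hxn : x ^ (-(α * n)) = (x ^ (-α)) ^ n := by
    rw [← Real.rpow_natCast, ← Real.rpow_mul hx.le]; congr 1; ring
  have hG : 0 ≤ Real.Gamma (α * n) := Real.Gamma_nonneg_of_nonneg (by positivity)
  have : ‖tailTerm x α θ n‖ = ‖Real.sin (Real.pi * (α * (1 + θ) / 2) * n)‖ *
      (Real.Gamma (α * n) / (n ! : ℝ) * (x ^ (-α)) ^ n) := by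
    rw [tailTerm, hxn, show Real.pi / 2 * α * n * (1 + θ) = Real.pi * (α * (1 + θ) / 2) * n by ring]
    simp only [norm_mul, norm_div, norm_pow, norm_neg, norm_one, one_pow, RCLike.norm_natCast]
    rw [Real.norm_of_nonneg hG, Real.norm_of_nonneg (Real.rpow_nonneg hx.le _)]
    ring
  rw [this]
  gcongr

/-! ### Euler's integral with a complex rate -/

lemma norm_exp_neg_mul (z : ℂ) (t : ℝ) : ‖Complex.exp (-z * t)‖ = Real.exp (-z.re * t) := by
  rw [Complex.norm_exp]; simp

lemma integrableOn_rpow_mul_exp {s b : ℝ} (hs : 0 < s) (hb : 0 < b) :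
    IntegrableOn (fun t : ℝ => t ^ (s - 1) * Real.exp (-b * t)) (Set.Ioi 0) := by
  simpa using integrableOn_rpow_mul_exp_neg_mul_rpow (p := 1) (s := s - 1) (by linarith)
    one_pos hb

lemma integral_rpow_mul_exp {s b : ℝ} (hs : 0 < s) (hb : 0 < b) :
    ∫ t in Set.Ioi (0 : ℝ), t ^ (s - 1) * Real.exp (-b * t) = b ^ (-s) * Real.Gamma s := by
  have := integral_rpow_mul_exp_neg_mul_rpow (p := 1) (q := s - 1) one_pos (by linarith) hb
  simpa using this

lemma integrableOn_rpow_mul_cexp {s : ℝ} {r : ℂ} (hs : 0 < s) (hr : 0 < r.re) :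
    IntegrableOn (fun t : ℝ => ((t ^ (s - 1) : ℝ) : ℂ) * Complex.exp (-r * t)) (Set.Ioi 0) := by
  refine (integrableOn_rpow_mul_exp hs hr).mono' (by fun_prop) ?_
  refine (ae_restrict_iff' measurableSet_Ioi).2 (Eventually.of_forall fun t ht => ?_)
  rw [norm_mul, norm_exp_neg_mul, Complex.norm_real,
    Real.norm_of_nonneg (Real.rpow_nonneg (le_of_lt ht) _)]

/-- Supplies the holomorphy needed to continue Euler's integral from real rates. On the half-plane
`Re w > Re r / 2` the differentiated integrand is dominated uniformly, the extra factor `t` raising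
`s` to `s + 1`. -/
lemma hasDerivAt_integral_rpow_mul_cexp {s : ℝ} {r : ℂ} (hs : 0 < s) (hr : 0 < r.re) :
    HasDerivAt (fun r : ℂ => ∫ t in Set.Ioi (0 : ℝ), ((t ^ (s - 1) : ℝ) : ℂ) * Complex.exp (-r * t))
      (∫ t in Set.Ioi (0 : ℝ), ((t ^ (s - 1) : ℝ) : ℂ) * (Complex.exp (-r * t) * (-t))) r := by
  have hmem : {w : ℂ | r.re / 2 < w.re} ∈ 𝓝 r :=
    (isOpen_lt continuous_const Complex.continuous_re).mem_nhds
      (show r.re / 2 < r.re by linarith)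
  refine (hasDerivAt_integral_of_dominated_loc_of_deriv_le (μ := volume.restrict (Set.Ioi 0))
    (F := fun (r : ℂ) (t : ℝ) => ((t ^ (s - 1) : ℝ) : ℂ) * Complex.exp (-r * t))
    (F' := fun (r : ℂ) (t : ℝ) => ((t ^ (s - 1) : ℝ) : ℂ) * (Complex.exp (-r * t) * (-t)))
    (s := {w : ℂ | r.re / 2 < w.re})
    (bound := fun t => t ^ (s + 1 - 1) * Real.exp (-(r.re / 2) * t)) hmem
    (Eventually.of_forall fun w => by fun_prop) (integrableOn_rpow_mul_cexp hs hr) (by fun_prop)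
    ?_ (integrableOn_rpow_mul_exp (by linarith) (by linarith)) ?_).2
  · refine (ae_restrict_iff' measurableSet_Ioi).2 (Eventually.of_forall fun t ht w hw => ?_)
    have ht' : (0 : ℝ) < t := ht
    rw [norm_mul, norm_mul, norm_exp_neg_mul, Complex.norm_real, norm_neg, Complex.norm_real,
      Real.norm_of_nonneg (Real.rpow_nonneg ht'.le _), Real.norm_of_nonneg ht'.le,
      show s + 1 - 1 = (s - 1) + 1 by ring, Real.rpow_add_one ht'.ne']
    have : Real.exp (-w.re * t) ≤ Real.exp (-(r.re / 2) * t) := by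
      apply Real.exp_le_exp.2
      have hw' : r.re / 2 < w.re := hw
      nlinarith
    calc _ = t ^ (s - 1) * t * Real.exp (-w.re * t) := by ring
      _ ≤ _ := by gcongr
  · refine Eventually.of_forall fun t w _ => ?_
    have := (((hasDerivAt_id w).neg.mul_const (t : ℂ)).cexp).const_mul ((t ^ (s - 1) : ℝ) : ℂ)
    simpa using this

/-- Euler's integral with a complex rate. -/
lemma integral_rpow_mul_cexp {s : ℝ} {r : ℂ} (hs : 0 < s) (hr : 0 < r.re) :
    ∫ t in Set.Ioi (0 : ℝ), ((t ^ (s - 1) : ℝ) : ℂ) * Complex.exp (-r * t) =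
      (1 / r) ^ (s : ℂ) * Real.Gamma s := by
  have hopen : IsOpen {r : ℂ | 0 < r.re} := isOpen_lt continuous_const Complex.continuous_re
  have hconv : Convex ℝ {r : ℂ | 0 < r.re} := convex_halfSpace_re_gt 0
  have hf : AnalyticOnNhd ℂ (fun r : ℂ => ∫ t in Set.Ioi (0 : ℝ),
      ((t ^ (s - 1) : ℝ) : ℂ) * Complex.exp (-r * t)) {r : ℂ | 0 < r.re} :=
    DifferentiableOn.analyticOnNhd (fun w hw =>
      (hasDerivAt_integral_rpow_mul_cexp hs hw).differentiableAt.differentiableWithinAt) hopen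
  have hg : AnalyticOnNhd ℂ (fun r : ℂ => (1 / r) ^ (s : ℂ) * Real.Gamma s) {r : ℂ | 0 < r.re} := by
    refine DifferentiableOn.analyticOnNhd (fun w hw => ?_) hopen
    have hw' : 0 < w.re := hw
    have hw0 : w ≠ 0 := by rintro rfl; simp at hw'
    have hslit : 1 / w ∈ Complex.slitPlane := by
      left; rw [one_div, Complex.inv_re]; exact div_pos hw' (Complex.normSq_pos.2 hw0)
    refine DifferentiableAt.differentiableWithinAt ?_
    exact (((differentiableAt_const _).div differentiableAt_id hw0).cpow
      (differentiableAt_const _) hslit).mul_const _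
  -- Identity theorem: both sides agree at the real points `1 + 1 / (n + 1)`, which accumulate at
  -- `1`.
  refine hf.eqOn_of_preconnected_of_frequently_eq hg hconv.isPreconnected (z₀ := 1) (by simp) ?_ hr
  have hreal : ∀ x : ℝ, 0 < x → ∫ t in Set.Ioi (0 : ℝ),
      ((t ^ (s - 1) : ℝ) : ℂ) * Complex.exp (-(x : ℂ) * t) =
      (1 / (x : ℂ)) ^ (s : ℂ) * Real.Gamma s := by
    intro x hx
    have h1 : (1 / (x : ℂ)) ^ (s : ℂ) = ((x ^ (-s) : ℝ) : ℂ) := by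
      rw [Real.rpow_neg hx.le, ← Real.inv_rpow hx.le, Complex.ofReal_cpow (inv_nonneg.2 hx.le)]
      simp
    rw [h1, ← Complex.ofReal_mul, ← integral_rpow_mul_exp hs hx, ← integral_complex_ofReal]
    congr 1; ext t; push_cast; rfl
  have hseq : Tendsto (fun n : ℕ => ((1 + 1 / ((n : ℝ) + 1) : ℝ) : ℂ)) atTop (𝓝[≠] 1) := by
    refine tendsto_nhdsWithin_iff.2 ⟨?_, Eventually.of_forall fun n => ?_⟩
    · have := (Complex.continuous_ofReal.tendsto _).comp
        ((tendsto_const_nhds (x := (1 : ℝ))).add tendsto_one_div_add_atTop_nhds_zero_nat)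
      simpa [Function.comp_def] using this
    · have : (0 : ℝ) < 1 / ((n : ℝ) + 1) := by positivity
      rw [Set.mem_compl_iff, Set.mem_singleton_iff, Complex.ofReal_eq_one]
      linarith
  refine hseq.frequently (Eventually.frequently (Eventually.of_forall fun n => ?_))
  exact hreal _ (by positivity)

/-! ### Convergent expansions of the Laplace transform for `α ≤ 1` -/

/-- The Laplace transform of the stretched exponential `exp (-c t^α)`. -/
noncomputable def stretchedLaplace (α : ℝ) (c z : ℂ) : ℂ :=
  ∫ t in Set.Ioi (0 : ℝ), Complex.exp (-z * t) * Complex.exp (-c * ((t ^ α : ℝ) : ℂ))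

/-- The terms of the expansion of `stretchedLaplace` in negative powers of `z`. -/
noncomputable def laplaceTerm (α : ℝ) (c z : ℂ) (n : ℕ) : ℂ :=
  (-c) ^ n / (n ! : ℂ) * ((1 / z) ^ ((α * n + 1 : ℝ) : ℂ) * Real.Gamma (α * n + 1))

lemma exp_term_eq (α : ℝ) (c z : ℂ) (n : ℕ) {t : ℝ} (ht : 0 < t) :
    Complex.exp (-z * t) * ((-c * ((t ^ α : ℝ) : ℂ)) ^ n / (n ! : ℂ)) =
      (-c) ^ n / (n ! : ℂ) * (((t ^ (α * n + 1 - 1) : ℝ) : ℂ) * Complex.exp (-z * t)) := by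
  rw [add_sub_cancel_right, Real.rpow_mul_natCast ht.le]
  push_cast; rw [mul_pow]; ring

lemma integrableOn_exp_term {α : ℝ} (hα : 0 < α) (c : ℂ) {z : ℂ} (hz : 0 < z.re) (n : ℕ) :
    IntegrableOn (fun t : ℝ => Complex.exp (-z * t) * ((-c * ((t ^ α : ℝ) : ℂ)) ^ n / (n ! : ℂ)))
      (Set.Ioi 0) := by
  refine IntegrableOn.congr_fun
    ((integrableOn_rpow_mul_cexp (s := α * n + 1) (by positivity) hz).const_mul
      ((-c) ^ n / (n ! : ℂ))) (fun t ht => (exp_term_eq α c z n ht).symm) measurableSet_Ioi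

lemma integral_exp_term {α : ℝ} (hα : 0 < α) (c : ℂ) {z : ℂ} (hz : 0 < z.re) (n : ℕ) :
    ∫ t in Set.Ioi (0 : ℝ), Complex.exp (-z * t) * ((-c * ((t ^ α : ℝ) : ℂ)) ^ n / (n ! : ℂ)) =
      laplaceTerm α c z n := by
  rw [setIntegral_congr_fun measurableSet_Ioi (fun t ht => exp_term_eq α c z n ht),
    integral_const_mul, integral_rpow_mul_cexp (by positivity) hz, laplaceTerm]

/-- The Taylor series of `exp (-c t^α)` may be integrated termwise: the integrals of the norms are
the terms of `summable_gamma_div_factorial`, which converges because `α < 1`. -/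
lemma hasSum_stretchedLaplace_of_re_pos {α : ℝ} (hα : 0 < α) (hα1 : α < 1) {c z : ℂ} (hc : c ≠ 0)
    (hz : 0 < z.re) : HasSum (laplaceTerm α c z) (stretchedLaplace α c z) := by
  have h := hasSum_integral_of_summable_integral_norm
    (F := fun n (t : ℝ) => Complex.exp (-z * t) * ((-c * ((t ^ α : ℝ) : ℂ)) ^ n / (n ! : ℂ)))
    (μ := volume.restrict (Set.Ioi 0)) (fun n => integrableOn_exp_term hα c hz n) ?_
  · simp_rw [integral_exp_term hα c hz] at h
    have he : ∀ t : ℝ, ∑' n : ℕ, Complex.exp (-z * t) *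
        ((-c * ((t ^ α : ℝ) : ℂ)) ^ n / (n ! : ℂ)) =
        Complex.exp (-z * t) * Complex.exp (-c * ((t ^ α : ℝ) : ℂ)) := fun t => by
      rw [tsum_mul_left, Complex.exp_eq_exp_ℂ, NormedSpace.exp_eq_tsum_div]
    simp_rw [he] at h
    exact h
  · have hn : ∀ n : ℕ, ∫ t in Set.Ioi (0 : ℝ),
        ‖Complex.exp (-z * t) * ((-c * ((t ^ α : ℝ) : ℂ)) ^ n / (n ! : ℂ))‖ =
        z.re⁻¹ * (Real.Gamma (α * n + 1) / (n ! : ℝ) * (‖c‖ * z.re ^ (-α)) ^ n) := by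
      intro n
      have : ∀ t ∈ Set.Ioi (0 : ℝ),
          ‖Complex.exp (-z * t) * ((-c * ((t ^ α : ℝ) : ℂ)) ^ n / (n ! : ℂ))‖ =
          ‖c‖ ^ n / (n ! : ℝ) * (t ^ (α * n + 1 - 1) * Real.exp (-z.re * t)) := by
        intro t ht
        rw [exp_term_eq α c z n ht, norm_mul, norm_mul, norm_exp_neg_mul, Complex.norm_real,
          Real.norm_of_nonneg (Real.rpow_nonneg (le_of_lt ht) _)]
        simp
      rw [setIntegral_congr_fun measurableSet_Ioi this, integral_const_mul,
        integral_rpow_mul_exp (by positivity) hz,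
        show -(α * n + 1) = -α * n - 1 by ring, Real.rpow_sub_one hz.ne',
        Real.rpow_mul_natCast hz.le, mul_pow]
      field_simp
    simp_rw [hn]
    exact (summable_gamma_div_factorial hα hα1 one_pos
      (mul_pos (norm_pos_iff.2 hc) (Real.rpow_pos_of_pos hz _))).mul_left _

/-- The bound involves only a lower bound for `‖z‖`, not `Re z`, so it remains uniform as `z`
approaches the imaginary axis. -/
lemma norm_laplaceTerm_le {α : ℝ} (hα : 0 < α) (c : ℂ) {z : ℂ} {x : ℝ} (hx : 0 < x)
    (hxz : x ≤ ‖z‖) (n : ℕ) : ‖laplaceTerm α c z n‖ ≤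
      x⁻¹ * (Real.Gamma (α * n + 1) / (n ! : ℝ) * (‖c‖ * x ^ (-α)) ^ n) := by
  have hG : 0 ≤ Real.Gamma (α * n + 1) := Real.Gamma_nonneg_of_nonneg (by positivity)
  have hz : z ≠ 0 := norm_pos_iff.1 (hx.trans_le hxz)
  have h1 : ‖(1 / z) ^ ((α * n + 1 : ℝ) : ℂ)‖ ≤ x⁻¹ * (x ^ (-α)) ^ n := by
    rw [Complex.norm_cpow_real, one_div, norm_inv, Real.inv_rpow (norm_nonneg _),
      ← Real.rpow_mul_natCast hx.le, ← Real.rpow_neg_one x, ← Real.rpow_add hx,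
      show -1 + -α * (n : ℝ) = -(α * n + 1) by ring, Real.rpow_neg hx.le]
    gcongr
  rw [laplaceTerm, norm_mul, norm_mul, norm_div, norm_pow, norm_neg, Complex.norm_natCast,
    Complex.norm_real, Real.norm_of_nonneg hG, mul_pow]
  calc _ ≤ ‖c‖ ^ n / (n ! : ℝ) * (x⁻¹ * (x ^ (-α)) ^ n * Real.Gamma (α * n + 1)) := by gcongr
    _ = _ := by field_simp

lemma integrableOn_exp_neg_rpow {α b : ℝ} (hα : 0 < α) (hb : 0 < b) :
    IntegrableOn (fun t : ℝ => Real.exp (-b * t ^ α)) (Set.Ioi 0) := by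
  simpa using integrableOn_rpow_mul_exp_neg_mul_rpow (s := 0) (by norm_num) hα hb

/-- The expansion of `stretchedLaplace` for `α < 1` on the imaginary axis. -/
lemma hasSum_stretchedLaplace {α : ℝ} (hα : 0 < α) (hα1 : α < 1) {c : ℂ} (hc : 0 < c.re)
    {x : ℝ} (hx : 0 < x) : HasSum (laplaceTerm α c (Complex.I * x))
      (stretchedLaplace α c (Complex.I * x)) := by
  have hc0 : c ≠ 0 := by rintro rfl; simp at hc
  -- Horizontal approach from the right half-plane: the imaginary part stays `x`, hence `‖z n‖ ≥ x`.
  set z : ℕ → ℂ := fun n => Complex.I * x + ((1 / ((n : ℝ) + 1) : ℝ) : ℂ) with hzdef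
  have hzre : ∀ n, 0 < (z n).re := fun n => by
    have : (0 : ℝ) < 1 / ((n : ℝ) + 1) := by positivity
    simp only [hzdef, Complex.add_re, Complex.ofReal_re]
    simpa using this
  have hzlim : Tendsto z atTop (𝓝 (Complex.I * x)) := by
    have := (tendsto_const_nhds (x := Complex.I * (x : ℂ))).add
      ((Complex.continuous_ofReal.tendsto _).comp tendsto_one_div_add_atTop_nhds_zero_nat)
    simpa [Function.comp_def, hzdef] using this
  have hznorm : ∀ n, x ≤ ‖z n‖ := fun n => by
    have h := Complex.abs_im_le_norm (z n)
    have h2 : (z n).im = x := by simp [hzdef]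
    rw [h2, abs_of_pos hx] at h
    exact h
  have hxnorm : x ≤ ‖Complex.I * (x : ℂ)‖ := by simp [abs_of_pos hx]
  have hsumm : Summable fun n : ℕ =>
      x⁻¹ * (Real.Gamma (α * n + 1) / (n ! : ℝ) * (‖c‖ * x ^ (-α)) ^ n) :=
    (summable_gamma_div_factorial hα hα1 one_pos
      (mul_pos (norm_pos_iff.2 hc0) (Real.rpow_pos_of_pos hx _))).mul_left _
  have h1 : Tendsto (fun k => ∑' n, laplaceTerm α c (z k) n) atTop
      (𝓝 (∑' n, laplaceTerm α c (Complex.I * x) n)) := by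
    refine tendsto_tsum_of_dominated_convergence hsumm (fun n => ?_)
      (Eventually.of_forall fun k n => norm_laplaceTerm_le hα c hx (hznorm k) n)
    have hx0 : Complex.I * (x : ℂ) ≠ 0 := by simp [hx.ne']
    have hslit : 1 / (Complex.I * (x : ℂ)) ∈ Complex.slitPlane := by
      right; simp [hx.ne']
    have hcont : ContinuousAt (laplaceTerm α c · n) (Complex.I * x) := by
      unfold laplaceTerm
      exact continuousAt_const.mul (((continuousAt_const.div continuousAt_id hx0).cpow
        continuousAt_const hslit).mul continuousAt_const)
    exact hcont.tendsto.comp hzlim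
  have h2 : Tendsto (fun k => stretchedLaplace α c (z k)) atTop
      (𝓝 (stretchedLaplace α c (Complex.I * x))) := by
    -- `exp (-z t)` loses its decay in the limit, so the dominating function comes from `Re c > 0`.
    refine tendsto_integral_of_dominated_convergence (fun t => Real.exp (-c.re * t ^ α))
      (fun k => by fun_prop) (integrableOn_exp_neg_rpow hα hc) (fun k => ?_)
      (Eventually.of_forall fun t => ?_)
    · refine (ae_restrict_iff' measurableSet_Ioi).2 (Eventually.of_forall fun t ht => ?_)
      have ht' : (0 : ℝ) < t := ht
      rw [norm_mul, norm_exp_neg_mul, norm_exp_neg_mul]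
      refine mul_le_of_le_one_left (Real.exp_pos _).le (Real.exp_le_one_iff.2 ?_)
      nlinarith [hzre k]
    · have hcont : Continuous fun w : ℂ =>
        Complex.exp (-w * t) * Complex.exp (-c * ((t ^ α : ℝ) : ℂ)) := by fun_prop
      exact (hcont.tendsto _).comp hzlim
  have h3 : ∀ k, ∑' n, laplaceTerm α c (z k) n = stretchedLaplace α c (z k) := fun k =>
    (hasSum_stretchedLaplace_of_re_pos hα hα1 hc0 (hzre k)).tsum_eq
  have h4 := tendsto_nhds_unique (h1.congr h3) h2
  rw [← h4]
  exact (Summable.of_norm_bounded hsumm fun n => norm_laplaceTerm_le hα c hx hxnorm n).hasSum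

/-- The expansion of `stretchedLaplace` for `α = 1`: a geometric series. -/
lemma hasSum_stretchedLaplace_one {c : ℂ} (hc : 0 < c.re) {x : ℝ} (hx : ‖c‖ < x) :
    HasSum (laplaceTerm 1 c (Complex.I * x)) (stretchedLaplace 1 c (Complex.I * x)) := by
  have hx0 : 0 < x := (norm_nonneg c).trans_lt hx
  have hz0 : Complex.I * (x : ℂ) ≠ 0 := by simp [hx0.ne']
  have h1 : stretchedLaplace 1 c (Complex.I * x) = 1 / (Complex.I * x + c) := by
    have := integral_exp_mul_complex_Ioi (a := -(Complex.I * x + c)) (by simpa using hc) 0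
    rw [stretchedLaplace]
    simp only [Complex.ofReal_zero, mul_zero, Complex.exp_zero, Real.rpow_one] at this ⊢
    rw [neg_div_neg_eq] at this
    rw [← this]
    congr 1; ext t
    rw [← Complex.exp_add]; congr 1; ring
  have h2 : ∀ n, laplaceTerm 1 c (Complex.I * x) n =
      (Complex.I * x)⁻¹ * (-c / (Complex.I * x)) ^ n := by
    intro n
    have hcast : ((1 * (n : ℝ) + 1 : ℝ) : ℂ) = ((n + 1 : ℕ) : ℂ) := by push_cast; ring
    rw [laplaceTerm, hcast, Complex.cpow_natCast, one_mul, Real.Gamma_nat_eq_factorial]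
    have : (n ! : ℂ) ≠ 0 := by exact_mod_cast n.factorial_ne_zero
    push_cast
    rw [div_pow, div_pow, pow_succ]
    generalize Complex.I * (x : ℂ) = z at hz0 ⊢
    field_simp
    ring
  rw [h1, funext h2]
  have hr : ‖-c / (Complex.I * (x : ℂ))‖ < 1 := by
    rw [norm_div, norm_neg, norm_mul, Complex.norm_I, one_mul, Complex.norm_real,
      Real.norm_of_nonneg hx0.le, div_lt_one hx0]
    exact hx
  have h3 := (hasSum_geometric_of_norm_lt_one hr).mul_left (Complex.I * (x : ℂ))⁻¹
  rwa [← mul_inv, mul_sub, mul_one, mul_div_cancel₀ _ hz0, sub_neg_eq_add, ← one_div (_ + c)] at h3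

/-! ### Rotation of the path and asymptotic expansion for `1 < α` -/

lemma one_div_polar_cpow {ρ η : ℝ} (hρ : 0 < ρ) (h1 : -Real.pi < η) (h2 : η < Real.pi) (q : ℝ) :
    (1 / ((ρ : ℂ) * Complex.exp (η * Complex.I))) ^ (q : ℂ) =
      ((ρ ^ (-q) : ℝ) : ℂ) * Complex.exp (-(η * q) * Complex.I) := by
  have h : 1 / ((ρ : ℂ) * Complex.exp (η * Complex.I)) =
      ((ρ⁻¹ : ℝ) : ℂ) * Complex.exp (((-η : ℝ) : ℂ) * Complex.I) := by
    rw [one_div, mul_inv, ← Complex.exp_neg]; push_cast; rw [neg_mul]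
  have hlog : Complex.log (Complex.exp (((-η : ℝ) : ℂ) * Complex.I)) =
      ((-η : ℝ) : ℂ) * Complex.I :=
    Complex.log_exp (by simp; linarith) (by simp; linarith)
  rw [h, Complex.cpow_def_of_ne_zero
    (mul_ne_zero (by simpa using hρ.ne') (Complex.exp_ne_zero _)),
    Complex.log_ofReal_mul (inv_pos.2 hρ) (Complex.exp_ne_zero _), hlog, Real.log_inv,
    Real.rpow_def_of_pos hρ, Complex.ofReal_exp, ← Complex.exp_add]
  congr 1; push_cast; ring

lemma norm_pow_mul_exp_rpow (α : ℝ) (c : ℂ) (k : ℕ) {t : ℝ} (ht : 0 < t) :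
    ‖((t : ℂ) ^ k * Complex.exp (-c * ((t ^ α : ℝ) : ℂ)))‖ =
      t ^ (k : ℝ) * Real.exp (-c.re * t ^ α) := by
  rw [norm_mul, norm_exp_neg_mul, norm_pow, Complex.norm_real, Real.norm_of_nonneg ht.le,
    Real.rpow_natCast]

lemma integrableOn_pow_mul_exp_rpow {α : ℝ} (hα : 0 < α) {c : ℂ} (hc : 0 < c.re) (k : ℕ) :
    IntegrableOn (fun t : ℝ => (t : ℂ) ^ k * Complex.exp (-c * ((t ^ α : ℝ) : ℂ)))
      (Set.Ioi 0) := by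
  refine (integrableOn_rpow_mul_exp_neg_mul_rpow (s := k) (by
    have : (0 : ℝ) ≤ k := Nat.cast_nonneg k
    linarith) hα hc).mono' (by fun_prop) ?_
  refine (ae_restrict_iff' measurableSet_Ioi).2 (Eventually.of_forall fun t ht => ?_)
  rw [norm_pow_mul_exp_rpow α c k ht]

/-- The moments of the stretched exponential with a complex rate. -/
lemma integral_pow_mul_exp_rpow {α : ℝ} (hα : 0 < α) {c : ℂ} (hc : 0 < c.re) (k : ℕ) :
    ∫ t in Set.Ioi (0 : ℝ), (t : ℂ) ^ k * Complex.exp (-c * ((t ^ α : ℝ) : ℂ)) =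
      1 / α * ((1 / c) ^ ((((k : ℝ) + 1) / α : ℝ) : ℂ) * Real.Gamma (((k : ℝ) + 1) / α)) := by
  -- The substitution of `t ^ α` for the variable reduces the moment to Euler's integral.
  rw [← integral_rpow_mul_cexp (s := ((k : ℝ) + 1) / α) (by positivity) hc,
    ← integral_comp_rpow_Ioi_of_pos (g := fun t : ℝ =>
      ((t ^ (((k : ℝ) + 1) / α - 1) : ℝ) : ℂ) * Complex.exp (-c * t)) hα, ← integral_const_mul]
  refine setIntegral_congr_fun measurableSet_Ioi fun t ht => ?_
  have ht' : (0 : ℝ) < t := ht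
  have h : α * t ^ (α - 1) * (t ^ α) ^ (((k : ℝ) + 1) / α - 1) = α * t ^ k := by
    rw [← Real.rpow_mul ht'.le, mul_assoc, ← Real.rpow_add ht', ← Real.rpow_natCast]
    congr 2; field_simp; ring
  have hα' : (α : ℂ) ≠ 0 := by exact_mod_cast hα.ne'
  simp only [Complex.real_smul]
  rw [← mul_assoc ((α * t ^ (α - 1) : ℝ) : ℂ), ← Complex.ofReal_mul, h]
  push_cast
  field_simp

/-- The Taylor series of `stretchedLaplace` for `1 < α`. -/
lemma hasSum_stretchedLaplace_pow {α : ℝ} (hα : 1 < α) {c z : ℂ} (hc : 0 < c.re) (hz : z ≠ 0) :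
    HasSum (fun k : ℕ => (-z) ^ k / (k ! : ℂ) *
      (1 / α * ((1 / c) ^ ((((k : ℝ) + 1) / α : ℝ) : ℂ) * Real.Gamma (((k : ℝ) + 1) / α))))
      (stretchedLaplace α c z) := by
  have hα0 : 0 < α := by linarith
  -- Here `exp (-z t)` is the factor expanded; the coefficients `Γ((k + 1) / α) / k!` are tame
  -- because `1 / α < 1`.
  have h := hasSum_integral_of_summable_integral_norm
    (F := fun (k : ℕ) (t : ℝ) => (-z) ^ k / (k ! : ℂ) *
      ((t : ℂ) ^ k * Complex.exp (-c * ((t ^ α : ℝ) : ℂ))))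
    (μ := volume.restrict (Set.Ioi 0))
    (fun k => (integrableOn_pow_mul_exp_rpow hα0 hc k).const_mul _) ?_
  · simp_rw [integral_const_mul, integral_pow_mul_exp_rpow hα0 hc] at h
    have he : ∀ t : ℝ, ∑' k : ℕ, (-z) ^ k / (k ! : ℂ) *
        ((t : ℂ) ^ k * Complex.exp (-c * ((t ^ α : ℝ) : ℂ))) =
        Complex.exp (-z * t) * Complex.exp (-c * ((t ^ α : ℝ) : ℂ)) := fun t => by
      rw [Complex.exp_eq_exp_ℂ, NormedSpace.exp_eq_tsum_div, ← tsum_mul_right]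
      congr 1; ext k; rw [mul_pow]; ring
    simp_rw [he] at h
    exact h
  · have hn : ∀ k : ℕ, ∫ t in Set.Ioi (0 : ℝ), ‖(-z) ^ k / (k ! : ℂ) *
        ((t : ℂ) ^ k * Complex.exp (-c * ((t ^ α : ℝ) : ℂ)))‖ =
        c.re ^ (-α⁻¹) * α⁻¹ * (Real.Gamma (α⁻¹ * k + α⁻¹) / (k ! : ℝ) *
          (‖z‖ * c.re ^ (-α⁻¹)) ^ k) := by
      intro k
      have : ∀ t ∈ Set.Ioi (0 : ℝ), ‖(-z) ^ k / (k ! : ℂ) *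
          ((t : ℂ) ^ k * Complex.exp (-c * ((t ^ α : ℝ) : ℂ)))‖ =
          ‖z‖ ^ k / (k ! : ℝ) * (t ^ (k : ℝ) * Real.exp (-c.re * t ^ α)) := by
        intro t ht
        rw [norm_mul, norm_pow_mul_exp_rpow α c k ht]
        simp
      rw [setIntegral_congr_fun measurableSet_Ioi this, integral_const_mul,
        integral_rpow_mul_exp_neg_mul_rpow hα0 (by
          have : (0 : ℝ) ≤ k := Nat.cast_nonneg k
          linarith) hc,
        show -((k : ℝ) + 1) / α = -α⁻¹ * k + -α⁻¹ by field_simp; ring,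
        show ((k : ℝ) + 1) / α = α⁻¹ * k + α⁻¹ by field_simp, Real.rpow_add hc,
        Real.rpow_mul_natCast hc.le, mul_pow]
      ring
    simp_rw [hn]
    exact (summable_gamma_div_factorial (inv_pos.2 hα0) (inv_lt_one_of_one_lt₀ hα)
      (inv_pos.2 hα0) (mul_pos (norm_pos_iff.2 hz) (Real.rpow_pos_of_pos hc _))).mul_left _

lemma exp_mul_I_re_pos {γ : ℝ} (h : |γ| < Real.pi / 2) :
    0 < (Complex.exp (γ * Complex.I)).re := by
  rw [Complex.exp_ofReal_mul_I_re]
  exact Real.cos_pos_of_mem_Ioo (abs_lt.1 h)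

/-- Rotation of the path of integration by the angle `-ψ`. -/
lemma stretchedLaplace_rotate {α γ ψ : ℝ} (hα : 1 < α) (hγ : |γ| < Real.pi / 2)
    (hγ' : |γ - α * ψ| < Real.pi / 2) {z : ℂ} (hz : z ≠ 0) :
    stretchedLaplace α (Complex.exp (γ * Complex.I)) z =
      Complex.exp (-(ψ * Complex.I)) *
        stretchedLaplace α (Complex.exp ((γ - α * ψ : ℝ) * Complex.I))
          (z * Complex.exp (-(ψ * Complex.I))) := by
  have hα0 : (α : ℂ) ≠ 0 := by exact_mod_cast (by linarith : α ≠ 0)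
  have hpi := Real.pi_pos
  have polar : ∀ δ : ℝ, |δ| < Real.pi / 2 → ∀ q : ℝ,
      (1 / Complex.exp (δ * Complex.I)) ^ (q : ℂ) = Complex.exp (-(δ * q) * Complex.I) := by
    intro δ hδ q
    have := one_div_polar_cpow (ρ := 1) (η := δ) one_pos (by linarith [(abs_lt.1 hδ).1])
      (by linarith [(abs_lt.1 hδ).2]) q
    simpa using this
  have h1 := hasSum_stretchedLaplace_pow hα (exp_mul_I_re_pos hγ) hz
  have h2 := (hasSum_stretchedLaplace_pow hα (exp_mul_I_re_pos hγ')
    (mul_ne_zero hz (Complex.exp_ne_zero (-(ψ * Complex.I))))).mul_left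
      (Complex.exp (-(ψ * Complex.I)))
  -- No contour is moved: both sides are power series in `z`, and their coefficients agree because
  -- `γ (k + 1) / α = ψ (k + 1) + (γ - α ψ) (k + 1) / α`.
  refine h1.unique ((congrArg (HasSum · _) (funext fun k => ?_)).mpr h2)
  rw [polar γ hγ, polar _ hγ']
  have hE : Complex.exp (-(γ * (((k : ℝ) + 1) / α : ℝ)) * Complex.I) =
      Complex.exp (-(ψ * Complex.I)) * Complex.exp (-(ψ * Complex.I)) ^ k *
        Complex.exp (-((γ - α * ψ : ℝ) * (((k : ℝ) + 1) / α : ℝ)) * Complex.I) := by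
    rw [← Complex.exp_nat_mul, ← Complex.exp_add, ← Complex.exp_add]
    congr 1; push_cast; field_simp; ring
  rw [hE, neg_mul_eq_neg_mul z, mul_pow]
  ring

/-- Along the segment `s ↦ s u`, which stays in the left half-plane, the derivative of each
remainder is `u` times the previous one. The mean value inequality then gives the induction; the
factor `1 / N!` is not needed. -/
lemma norm_exp_sub_sum_le {u : ℂ} (hu : u.re ≤ 0) (N : ℕ) :
    ‖Complex.exp u - ∑ n ∈ Finset.range N, u ^ n / (n ! : ℂ)‖ ≤ ‖u‖ ^ N := by
  induction N generalizing u with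
  | zero => simpa [Complex.norm_exp] using hu
  | succ N ih =>
    have hd : ∀ s : ℝ, HasDerivAt (fun s : ℝ => Complex.exp (s * u) -
        ∑ n ∈ Finset.range (N + 1), ((s : ℂ) * u) ^ n / (n ! : ℂ))
        (u * (Complex.exp (s * u) - ∑ n ∈ Finset.range N, ((s : ℂ) * u) ^ n / (n ! : ℂ))) s := by
      intro s
      have hlin : HasDerivAt (fun s : ℝ => (s : ℂ) * u) u s := by
        simpa using (Complex.ofRealCLM.hasDerivAt (x := s)).mul_const u
      have hpow : ∀ n : ℕ, HasDerivAt (fun s : ℝ => ((s : ℂ) * u) ^ (n + 1) / ((n + 1)! : ℂ))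
          (u * (((s : ℂ) * u) ^ n / (n ! : ℂ))) s := by
        intro n
        have := (hlin.pow (n + 1)).div_const (((n + 1)! : ℕ) : ℂ)
        refine this.congr_deriv ?_
        have h1 : (n ! : ℂ) ≠ 0 := by exact_mod_cast n.factorial_ne_zero
        have h2 : (n : ℂ) + 1 ≠ 0 := by exact_mod_cast n.succ_ne_zero
        rw [Nat.factorial_succ]
        push_cast
        field_simp
      have hs := HasDerivAt.fun_sum (u := Finset.range N) fun n _ => hpow n
      simp_rw [Finset.sum_range_succ' _ N, pow_zero]
      refine ((hlin.cexp).fun_sub (hs.add_const _)).congr_deriv ?_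
      rw [mul_sub, Finset.mul_sum, mul_comm u]
    have hb : ∀ s ∈ Set.Ico (0 : ℝ) 1, ‖u * (Complex.exp (s * u) -
        ∑ n ∈ Finset.range N, ((s : ℂ) * u) ^ n / (n ! : ℂ))‖ ≤ ‖u‖ ^ (N + 1) := by
      intro s hs
      have hre : ((s : ℂ) * u).re ≤ 0 := by
        rw [Complex.re_ofReal_mul]; exact mul_nonpos_of_nonneg_of_nonpos hs.1 hu
      rw [norm_mul, pow_succ']
      gcongr
      refine (ih hre).trans ?_
      gcongr
      rw [norm_mul, Complex.norm_real, Real.norm_of_nonneg hs.1]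
      exact mul_le_of_le_one_left (norm_nonneg _) hs.2.le
    have := norm_image_sub_le_of_norm_deriv_le_segment_01'
      (fun s _ => (hd s).hasDerivWithinAt) hb
    simpa [Finset.sum_range_succ', zero_pow] using this

/-- The remainder of `exp (-c t^α)` is at most `(‖c‖ t^α)^N`, and Euler's integral evaluates this
against `exp (-Re z t)`. Convergence of the full series plays no role. -/
lemma norm_stretchedLaplace_sub_sum_le {α : ℝ} (hα : 0 < α) {c z : ℂ} (hc : 0 < c.re)
    (hz : 0 < z.re) (N : ℕ) :
    ‖stretchedLaplace α c z - ∑ n ∈ Finset.range N, laplaceTerm α c z n‖ ≤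
      ‖c‖ ^ N * (z.re ^ (-(α * N + 1)) * Real.Gamma (α * N + 1)) := by
  have hint : IntegrableOn (fun t : ℝ => Complex.exp (-z * t) *
      Complex.exp (-c * ((t ^ α : ℝ) : ℂ))) (Set.Ioi 0) := by
    refine (integrableOn_exp_neg_rpow hα hc).mono' (by fun_prop) ?_
    refine (ae_restrict_iff' measurableSet_Ioi).2 (Eventually.of_forall fun t ht => ?_)
    have ht' : (0 : ℝ) < t := ht
    rw [norm_mul, norm_exp_neg_mul, norm_exp_neg_mul]
    refine mul_le_of_le_one_left (Real.exp_pos _).le (Real.exp_le_one_iff.2 ?_)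
    nlinarith
  simp_rw [← integral_exp_term hα c hz]
  rw [stretchedLaplace, ← integral_finsetSum _ fun n _ => integrableOn_exp_term hα c hz n,
    ← integral_sub hint (integrable_finsetSum _ fun n _ => integrableOn_exp_term hα c hz n),
    ← integral_rpow_mul_exp (by positivity) hz, ← integral_const_mul]
  refine norm_integral_le_of_norm_le ((integrableOn_rpow_mul_exp (by positivity) hz).const_mul _) ?_
  refine (ae_restrict_iff' measurableSet_Ioi).2 (Eventually.of_forall fun t ht => ?_)
  have ht' : (0 : ℝ) < t := ht
  have htα : 0 ≤ t ^ α := Real.rpow_nonneg ht'.le _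
  rw [← Finset.mul_sum, ← mul_sub, norm_mul, norm_exp_neg_mul, add_sub_cancel_right,
    Real.rpow_mul_natCast ht'.le, mul_comm, ← mul_assoc, ← mul_pow]
  gcongr
  refine (norm_exp_sub_sum_le ?_ N).trans_eq ?_
  · rw [Complex.re_mul_ofReal, Complex.neg_re]
    exact mul_nonpos_of_nonpos_of_nonneg (by linarith) htα
  · rw [norm_mul, norm_neg, Complex.norm_real, Real.norm_of_nonneg htα]

lemma laplaceTerm_polar {α γ ρ η : ℝ} (hρ : 0 < ρ) (h1 : -Real.pi < η) (h2 : η < Real.pi) (n : ℕ) :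
    laplaceTerm α (Complex.exp (γ * Complex.I)) ((ρ : ℂ) * Complex.exp (η * Complex.I)) n =
      (((-1) ^ n / (n ! : ℝ) * Real.Gamma (α * n + 1) * ρ ^ (-(α * n + 1)) : ℝ) : ℂ) *
        Complex.exp ((γ * n - η * (α * n + 1) : ℝ) * Complex.I) := by
  have hE : Complex.exp ((γ * n - η * (α * n + 1) : ℝ) * Complex.I) =
      Complex.exp (γ * Complex.I) ^ n *
        Complex.exp (-(η * (α * n + 1 : ℝ)) * Complex.I) := by
    rw [← Complex.exp_nat_mul, ← Complex.exp_add]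
    congr 1; push_cast; ring
  rw [laplaceTerm, one_div_polar_cpow hρ h1 h2, hE, neg_pow]
  push_cast
  ring

/-- The terms of the expansion of the density of the stable law. -/
noncomputable def densityTerm (α θ x : ℝ) (n : ℕ) : ℝ :=
  (-1) ^ (n + 1) / (n ! : ℝ) * Real.Gamma (α * n + 1) *
    Real.sin (Real.pi / 2 * α * n * (1 + θ)) * x ^ (-(α * n + 1))

lemma I_mul_eq_polar (x : ℝ) :
    Complex.I * x = (x : ℂ) * Complex.exp ((Real.pi / 2 : ℝ) * Complex.I) := by
  push_cast
  rw [Complex.exp_pi_div_two_mul_I, mul_comm]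

/-- The phase is `-(π α n (1 + θ) / 2 + π / 2)`; the quarter turn changes the cosine into minus the
sine, whence the sign `(-1)^(n + 1)`. -/
lemma re_laplaceTerm (α θ : ℝ) {x : ℝ} (hx : 0 < x) (n : ℕ) :
    (laplaceTerm α (Complex.exp ((-(Real.pi / 2 * α * θ) : ℝ) * Complex.I)) (Complex.I * x) n).re =
      densityTerm α θ x n := by
  rw [I_mul_eq_polar, laplaceTerm_polar hx (by linarith [Real.pi_pos]) (by linarith [Real.pi_pos]),
    Complex.re_ofReal_mul, Complex.exp_ofReal_mul_I_re, densityTerm,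
    show -(Real.pi / 2 * α * θ) * n - Real.pi / 2 * (α * n + 1) =
      -(Real.pi / 2 * α * n * (1 + θ) + Real.pi / 2) by ring, Real.cos_neg, Real.cos_add_pi_div_two]
  ring

/-- The asymptotic expansion of `stretchedLaplace` on the imaginary axis for `1 < α`. -/
lemma exists_norm_stretchedLaplace_sub_le {α γ : ℝ} (hα : 1 < α) (hγ : |γ| < Real.pi / 2)
    (N : ℕ) : ∃ C : ℝ, ∀ x : ℝ, 0 < x →
      ‖stretchedLaplace α (Complex.exp (γ * Complex.I)) (Complex.I * x) -
        ∑ n ∈ Finset.range N, laplaceTerm α (Complex.exp (γ * Complex.I)) (Complex.I * x) n‖ ≤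
      C * x ^ (-(α * N + 1)) := by
  have hpi := Real.pi_pos
  obtain ⟨hγ1, hγ2⟩ := abs_lt.1 hγ
  -- `ψ > 0` gives the rotated `i x` the real part `x sin ψ > 0`, while `α ψ < γ + π / 2` keeps the
  -- rotated exponent decaying. As `1 < α`, the latter also yields `ψ < π`.
  obtain ⟨ψ, hψ0, hψ1⟩ := exists_between
    (show 0 < (γ + Real.pi / 2) / α from div_pos (by linarith) (by linarith))
  rw [lt_div_iff₀ (by linarith)] at hψ1
  have hψ2 : ψ < Real.pi := by nlinarith
  have hγ' : |γ - α * ψ| < Real.pi / 2 := abs_lt.2 ⟨by linarith, by nlinarith⟩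
  have hsin : 0 < Real.sin ψ := Real.sin_pos_of_pos_of_lt_pi hψ0 hψ2
  refine ⟨Real.sin ψ ^ (-(α * N + 1)) * Real.Gamma (α * N + 1), fun x hx => ?_⟩
  have hx0 : Complex.I * (x : ℂ) ≠ 0 := by simp [hx.ne']
  have hzw : Complex.I * x * Complex.exp (-(ψ * Complex.I)) =
      (x : ℂ) * Complex.exp ((Real.pi / 2 - ψ : ℝ) * Complex.I) := by
    rw [I_mul_eq_polar, mul_assoc, ← Complex.exp_add]
    congr 2; push_cast; ring
  have hterm : ∀ n, laplaceTerm α (Complex.exp (γ * Complex.I)) (Complex.I * x) n =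
      Complex.exp (-(ψ * Complex.I)) * laplaceTerm α
        (Complex.exp ((γ - α * ψ : ℝ) * Complex.I)) (Complex.I * x * Complex.exp (-(ψ * Complex.I)))
          n := by
    intro n
    rw [hzw, I_mul_eq_polar, laplaceTerm_polar hx (by linarith) (by linarith),
      laplaceTerm_polar hx (by linarith) (by linarith), mul_left_comm, ← Complex.exp_add]
    congr 2; push_cast; ring
  have hre : (Complex.I * x * Complex.exp (-(ψ * Complex.I))).re = x * Real.sin ψ := by
    rw [hzw, Complex.re_ofReal_mul, Complex.exp_ofReal_mul_I_re, Real.cos_pi_div_two_sub]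
  rw [stretchedLaplace_rotate hα hγ hγ' hx0, Finset.sum_congr rfl fun n _ => hterm n,
    ← Finset.mul_sum, ← mul_sub, norm_mul,
    show Complex.exp (-(ψ * Complex.I)) = Complex.exp ((-ψ : ℝ) * Complex.I) by
      push_cast; rw [neg_mul],
    Complex.norm_exp_ofReal_mul_I, one_mul]
  have hneg : (((-ψ : ℝ) : ℂ) * Complex.I) = -(ψ * Complex.I) := by push_cast; ring
  rw [hneg]
  refine (norm_stretchedLaplace_sub_sum_le (by linarith) (exp_mul_I_re_pos hγ')
    (by rw [hre]; positivity) N).trans_eq ?_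
  rw [hre, Complex.norm_exp_ofReal_mul_I, one_pow, one_mul, Real.mul_rpow hx.le hsin.le]
  ring

/-! ### Termwise integration from density to tail -/

lemma densityTerm_zero (α θ x : ℝ) : densityTerm α θ x 0 = 0 := by simp [densityTerm]

lemma tailTerm_zero (x α θ : ℝ) : tailTerm x α θ 0 = 0 := by simp [tailTerm]

lemma sum_range_tailTerm (x α θ : ℝ) (N : ℕ) :
    ∑ n ∈ Finset.range N, tailTerm x α θ n = ∑ n ∈ Finset.Ico 1 N, tailTerm x α θ n := by
  rcases N with _ | N
  · simp
  · rw [Finset.range_eq_Ico, Finset.sum_eq_sum_Ico_succ_bot (by omega), tailTerm_zero, zero_add]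

lemma integrableOn_densityTerm {α : ℝ} (hα : 0 < α) (θ : ℝ) {y : ℝ} (hy : 0 < y) (n : ℕ) :
    IntegrableOn (fun x => densityTerm α θ x n) (Set.Ioi y) := by
  rcases Nat.eq_zero_or_pos n with rfl | hn
  · simp only [densityTerm_zero]; exact integrableOn_zero
  · have : 0 < α * n := by positivity
    exact (integrableOn_Ioi_rpow_of_lt (by linarith) hy).const_mul _

lemma integral_densityTerm {α : ℝ} (hα : 0 < α) (θ : ℝ) {y : ℝ} (hy : 0 < y) (n : ℕ) :
    ∫ x in Set.Ioi y, densityTerm α θ x n = tailTerm y α θ n := by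
  rcases Nat.eq_zero_or_pos n with rfl | hn
  · simp [densityTerm_zero, tailTerm_zero]
  · have h : 0 < α * n := by positivity
    simp only [densityTerm]
    rw [integral_const_mul, integral_Ioi_rpow_of_lt (by linarith) hy, Real.Gamma_add_one h.ne',
      tailTerm, show -(α * n + 1) + 1 = -(α * n) by ring, neg_div_neg_eq]
    field_simp

lemma norm_densityTerm (α θ : ℝ) {x : ℝ} (hx : 0 < x) (n : ℕ) :
    ‖densityTerm α θ x n‖ = ‖(-1) ^ (n + 1) / (n ! : ℝ) * Real.Gamma (α * n + 1) *
    Real.sin (Real.pi / 2 * α * n * (1 + θ))‖ * x ^ (-(α * n + 1)) := by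
  rw [densityTerm, norm_mul _ (x ^ _), Real.norm_of_nonneg (Real.rpow_nonneg hx.le (-(α * n + 1)))]

/-- Each term is a constant times a positive power, so nothing cancels on the half-line. -/
lemma integral_norm_densityTerm {α : ℝ} (hα : 0 < α) (θ : ℝ) {y : ℝ} (hy : 0 < y) (n : ℕ) :
    ∫ x in Set.Ioi y, ‖densityTerm α θ x n‖ = ‖tailTerm y α θ n‖ := by
  rw [← integral_densityTerm hα θ hy,
    setIntegral_congr_fun measurableSet_Ioi fun x (hx : x ∈ Set.Ioi y) =>
      norm_densityTerm α θ (hy.trans (Set.mem_Ioi.1 hx)) n,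
    integral_const_mul]
  simp only [densityTerm]
  rw [integral_const_mul, norm_mul _ (∫ _ in _, _),
    Real.norm_of_nonneg (r := ∫ _ in _, _)]
  exact setIntegral_nonneg measurableSet_Ioi fun x (hx : x ∈ Set.Ioi y) =>
    Real.rpow_nonneg (hy.trans (Set.mem_Ioi.1 hx)).le _

/-- Separates the variables: a power of `x` integrable at infinity times a summable sequence in `n`.
The spare factor `x^(-α (n - 1))` is compared with its value at `y`, which requires `n ≥ 1`; the
term at `n = 0` vanishes. -/
lemma norm_densityTerm_le {α : ℝ} (hα : 0 < α) (θ : ℝ) {x y : ℝ} (hy : 0 < y) (hx : y ≤ x)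
    (n : ℕ) : ‖densityTerm α θ x n‖ ≤
      y ^ α * x ^ (-α - 1) * (Real.Gamma (α * n + 1) / (n ! : ℝ) * (y ^ (-α)) ^ n) := by
  have hx0 := hy.trans_le hx
  have hG : 0 ≤ Real.Gamma (α * n + 1) := Real.Gamma_nonneg_of_nonneg (by positivity)
  rcases Nat.eq_zero_or_pos n with rfl | hn
  · rw [densityTerm_zero, norm_zero]; positivity
  · rw [norm_densityTerm α θ hx0]
    have h1 : ‖(-1) ^ (n + 1) / (n ! : ℝ) * Real.Gamma (α * n + 1) *
        Real.sin (Real.pi / 2 * α * n * (1 + θ))‖ ≤ Real.Gamma (α * n + 1) / (n ! : ℝ) := by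
      simp only [norm_mul, norm_div, norm_pow, norm_neg, norm_one, one_pow, RCLike.norm_natCast]
      rw [Real.norm_of_nonneg hG, one_div, inv_mul_eq_div]
      exact mul_le_of_le_one_right (by positivity) (Real.abs_sin_le_one _)
    have h2 : x ^ (-(α * n + 1)) ≤ y ^ α * x ^ (-α - 1) * (y ^ (-α)) ^ n := by
      have hn1 : (1 : ℝ) ≤ n := by exact_mod_cast hn
      rw [show -(α * n + 1) = (-α - 1) + (-(α * (n - 1))) by ring, Real.rpow_add hx0,
        ← Real.rpow_mul_natCast hy.le, mul_comm (y ^ α), mul_assoc, ← Real.rpow_add hy,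
        show α + -α * n = -(α * (n - 1)) by ring, Real.rpow_neg hx0.le, Real.rpow_neg hy.le]
      have : 0 ≤ α * ((n : ℝ) - 1) := mul_nonneg hα.le (by linarith)
      gcongr
    calc _ ≤ Real.Gamma (α * n + 1) / (n ! : ℝ) * (y ^ α * x ^ (-α - 1) * (y ^ (-α)) ^ n) := by
          gcongr
      _ = _ := by ring

lemma norm_tailTerm_le {α : ℝ} (hα : 0 < α) (θ : ℝ) {y : ℝ} (hy : 0 < y) (n : ℕ) :
    ‖tailTerm y α θ n‖ ≤ α⁻¹ * (Real.Gamma (α * n + 1) / (n ! : ℝ) * (y ^ (-α)) ^ n) := by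
  have hb : ∀ x ∈ Set.Ioi y, ‖densityTerm α θ x n‖ ≤
      y ^ α * (Real.Gamma (α * n + 1) / (n ! : ℝ) * (y ^ (-α)) ^ n) * x ^ (-α - 1) := fun x hx =>
    (norm_densityTerm_le hα θ hy (le_of_lt hx) n).trans_eq (by ring)
  rw [← integral_norm_densityTerm hα θ hy]
  refine (setIntegral_mono_on (integrableOn_densityTerm hα θ hy n).norm
    ((integrableOn_Ioi_rpow_of_lt (by linarith) hy).const_mul _) measurableSet_Ioi hb).trans_eq ?_
  rw [integral_const_mul, integral_Ioi_rpow_of_lt (by linarith) hy,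
    show -α - 1 + 1 = -α by ring, neg_div_neg_eq, mul_right_comm, ← mul_div_assoc,
    ← Real.rpow_add hy, add_neg_cancel, Real.rpow_zero, one_div]

/-- Termwise integration of a convergent expansion of a density. -/
lemma hasSum_tailTerm {p : ℝ → ℝ} (hp : Continuous p) {α θ y : ℝ} (hα : 0 < α) (hy : 0 < y)
    (hG : Summable fun n : ℕ => Real.Gamma (α * n + 1) / (n ! : ℝ) * (y ^ (-α)) ^ n)
    (h : ∀ x, y < x → HasSum (densityTerm α θ x) (Real.pi * p x)) :
    IntegrableOn p (Set.Ioi y) ∧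
      HasSum (tailTerm y α θ) (Real.pi * ∫ x in Set.Ioi y, p x) := by
  constructor
  · have hint : IntegrableOn (fun x => Real.pi * p x) (Set.Ioi y) := by
      refine ((integrableOn_Ioi_rpow_of_lt (a := -α - 1) (by linarith) hy).const_mul
        (y ^ α * ∑' n : ℕ, Real.Gamma (α * n + 1) / (n ! : ℝ) * (y ^ (-α)) ^ n)).mono'
        (by fun_prop) ?_
      refine (ae_restrict_iff' measurableSet_Ioi).2 (Eventually.of_forall fun x hx => ?_)
      rw [← (h x hx).tsum_eq]
      refine (tsum_of_norm_bounded (hG.mul_left (y ^ α * x ^ (-α - 1))).hasSum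
        (norm_densityTerm_le hα θ hy (le_of_lt hx))).trans_eq ?_
      rw [tsum_mul_left]; ring
    simpa [← mul_assoc, Real.pi_ne_zero, IntegrableOn] using hint.const_mul Real.pi⁻¹
  · have h1 := hasSum_integral_of_summable_integral_norm
      (F := fun n x => densityTerm α θ x n) (μ := volume.restrict (Set.Ioi y))
      (integrableOn_densityTerm hα θ hy) (by
        simp_rw [integral_norm_densityTerm hα θ hy]
        exact Summable.of_nonneg_of_le (fun _ => norm_nonneg _) (norm_tailTerm_le hα θ hy)
          (hG.mul_left _))
    simp_rw [integral_densityTerm hα θ hy] at h1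
    rwa [setIntegral_congr_fun measurableSet_Ioi fun x hx => (h x hx).tsum_eq,
      integral_const_mul] at h1

/-- Termwise integration of an asymptotic expansion of a density. -/
lemma abs_integral_sub_tailPartialSum_le {p : ℝ → ℝ} (hp : Continuous p) {α θ C : ℝ} (hα : 0 < α)
    {N : ℕ} (hN : 1 ≤ N)
    (h : ∀ x, 0 < x → |Real.pi * p x - ∑ n ∈ Finset.range N, densityTerm α θ x n| ≤
      C * x ^ (-(α * N + 1))) {y : ℝ} (hy : 0 < y) :
    IntegrableOn p (Set.Ioi y) ∧ |(∫ x in Set.Ioi y, p x) - tailPartialSum N y α θ| ≤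
      C / (Real.pi * (α * N)) * y ^ (-(α * N)) := by
  have hαN : 0 < α * N := by positivity
  have hsum : IntegrableOn (fun x => ∑ n ∈ Finset.range N, densityTerm α θ x n) (Set.Ioi y) :=
    integrable_finsetSum _ fun n _ => integrableOn_densityTerm hα θ hy n
  have hpow : IntegrableOn (fun x : ℝ => C * x ^ (-(α * N + 1))) (Set.Ioi y) :=
    (integrableOn_Ioi_rpow_of_lt (by linarith) hy).const_mul _
  have hb : ∀ᵐ x ∂volume.restrict (Set.Ioi y),
      ‖Real.pi * p x - ∑ n ∈ Finset.range N, densityTerm α θ x n‖ ≤ C * x ^ (-(α * N + 1)) :=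
    (ae_restrict_iff' measurableSet_Ioi).2 (Eventually.of_forall fun x hx => h x (hy.trans hx))
  have hdiff : IntegrableOn (fun x => Real.pi * p x - ∑ n ∈ Finset.range N, densityTerm α θ x n)
      (Set.Ioi y) :=
    hpow.mono' ((continuous_const.mul hp).aestronglyMeasurable.sub hsum.1) hb
  have hint : IntegrableOn (fun x => Real.pi * p x) (Set.Ioi y) := by
    refine (Integrable.add hdiff hsum).congr (Eventually.of_forall fun x => ?_)
    simp
  refine ⟨by simpa [← mul_assoc, Real.pi_ne_zero, IntegrableOn] using hint.const_mul Real.pi⁻¹, ?_⟩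
  have h1 := norm_integral_le_of_norm_le hpow hb
  rw [integral_sub hint hsum, integral_const_mul, integral_const_mul,
    integral_finsetSum _ fun n _ => integrableOn_densityTerm hα θ hy n,
    Finset.sum_congr rfl fun n _ => integral_densityTerm hα θ hy n, sum_range_tailTerm,
    integral_Ioi_rpow_of_lt (by linarith) hy, show -(α * N + 1) + 1 = -(α * N) by ring,
    neg_div_neg_eq, Real.norm_eq_abs] at h1
  have hpi := Real.pi_pos
  have h2 : (∫ x in Set.Ioi y, p x) - tailPartialSum N y α θ =
      Real.pi⁻¹ * (Real.pi * (∫ x in Set.Ioi y, p x) -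
        ∑ n ∈ Finset.Ico 1 N, tailTerm y α θ n) := by
    rw [tailPartialSum]; field_simp
  rw [h2, abs_mul, abs_of_pos (inv_pos.2 hpi)]
  calc _ ≤ Real.pi⁻¹ * (C * (y ^ (-(α * N)) / (α * N))) := by gcongr
    _ = _ := by field_simp

/-! ### Tails and atoms from the density -/

open scoped FourierTransform in
lemma continuous_fourier_charFun (μ : Measure ℝ)
    (hφ : Integrable (fun v : ℝ => charFun μ (2 * Real.pi * v))) :
    Continuous (𝓕 (fun v : ℝ => charFun μ (2 * Real.pi * v))) :=
  VectorFourier.fourierIntegral_continuous Real.continuous_fourierChar continuous_inner hφ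

open scoped FourierTransform in
lemma measureReal_Ioo_eq_re (μ : Measure ℝ) [IsFiniteMeasure μ]
    (hφ : Integrable (fun v : ℝ => charFun μ (2 * Real.pi * v))) (a b : ℝ) :
    μ.real (Set.Ioo a b) =
      ∫ x in Set.Ioo a b, (𝓕 (fun v : ℝ => charFun μ (2 * Real.pi * v)) x).re := by
  have h := congrArg Complex.re (measureReal_Ioo_eq μ hφ a b)
  rw [Complex.ofReal_re] at h
  rw [h]
  exact (integral_re (((continuous_fourier_charFun μ hφ).integrableOn_Icc).mono_set
    Set.Ioo_subset_Icc_self)).symm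

open scoped FourierTransform in
/-- The tails of a measure with integrable characteristic function are integrals of its density. -/
lemma measureReal_Ioi_eq (μ : Measure ℝ) [IsFiniteMeasure μ]
    (hφ : Integrable (fun v : ℝ => charFun μ (2 * Real.pi * v))) {y : ℝ}
    (hint : IntegrableOn (fun x => (𝓕 (fun v : ℝ => charFun μ (2 * Real.pi * v)) x).re)
      (Set.Ioi y)) :
    μ.real (Set.Ioi y) =
      ∫ x in Set.Ioi y, (𝓕 (fun v : ℝ => charFun μ (2 * Real.pi * v)) x).re := by
  have hU : (⋃ n : ℕ, Set.Ioo y n) = Set.Ioi y := by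
    ext x
    simp only [Set.mem_iUnion, Set.mem_Ioo, Set.mem_Ioi]
    exact ⟨fun ⟨n, h, _⟩ => h, fun h => (exists_nat_gt x).imp fun n hn => ⟨h, hn⟩⟩
  have h1 : Tendsto (fun n : ℕ => μ.real (Set.Ioo y n)) atTop (𝓝 (μ.real (Set.Ioi y))) := by
    have hm : Monotone fun n : ℕ => Set.Ioo y (n : ℝ) := fun m n hmn =>
      Set.Ioo_subset_Ioo_right (by exact_mod_cast hmn)
    have := tendsto_measure_iUnion_atTop (μ := μ) hm
    rw [hU] at this
    exact (ENNReal.tendsto_toReal (measure_ne_top μ _)).comp this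
  refine tendsto_nhds_unique h1 ?_
  refine ((intervalIntegral_tendsto_integral_Ioi y hint tendsto_natCast_atTop_atTop).congr' ?_)
  filter_upwards [tendsto_natCast_atTop_atTop.eventually_ge_atTop y] with n hn
  rw [measureReal_Ioo_eq_re μ hφ, intervalIntegral.integral_of_le hn, integral_Ioc_eq_integral_Ioo]

-- An atom at `a` would be bounded by the integrals of a continuous function over intervals
-- shrinking to `a`. Atomlessness is what lets left tails with and without their endpoint be
-- identified.
open scoped FourierTransform in
lemma nullSingletonClass_of_integrable_charFun (μ : Measure ℝ) [IsFiniteMeasure μ]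
    (hφ : Integrable (fun v : ℝ => charFun μ (2 * Real.pi * v))) : NullSingletonClass μ := by
  refine ⟨fun a => ?_⟩
  set q := 𝓕 (fun v : ℝ => charFun μ (2 * Real.pi * v))
  have hq : Continuous q := continuous_fourier_charFun μ hφ
  have hii : ∀ u v : ℝ, IntervalIntegrable (fun x => (q x).re) volume u v := fun u v =>
    (Complex.continuous_re.comp hq).intervalIntegrable _ _
  have hcont : Continuous fun b => ∫ x in (a - 1)..b, (q x).re :=
    intervalIntegral.continuous_primitive hii _
  have hlim : Tendsto (fun n : ℕ => (∫ x in (a - 1)..(a + 1 / ((n : ℝ) + 1)), (q x).re) -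
      ∫ x in (a - 1)..(a - 1 / ((n : ℝ) + 1)), (q x).re) atTop (𝓝 0) := by
    have h0 := tendsto_one_div_add_atTop_nhds_zero_nat (𝕜 := ℝ)
    have h1 := (hcont.tendsto (a + 0)).comp (h0.const_add a)
    have h2 := (hcont.tendsto (a - 0)).comp (h0.const_sub a)
    have := h1.sub h2
    simpa [Function.comp_def] using this
  have hle : ∀ n : ℕ, μ.real {a} ≤ (∫ x in (a - 1)..(a + 1 / ((n : ℝ) + 1)), (q x).re) -
      ∫ x in (a - 1)..(a - 1 / ((n : ℝ) + 1)), (q x).re := by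
    intro n
    have hpos : (0 : ℝ) < 1 / ((n : ℝ) + 1) := by positivity
    rw [intervalIntegral.integral_interval_sub_left (hii _ _) (hii _ _),
      intervalIntegral.integral_of_le (by linarith), integral_Ioc_eq_integral_Ioo,
      ← measureReal_Ioo_eq_re μ hφ]
    refine measureReal_mono ?_
    rw [Set.singleton_subset_iff]
    exact ⟨by linarith, by linarith⟩
  have h0 : μ.real {a} = 0 :=
    le_antisymm (ge_of_tendsto' hlim hle) measureReal_nonneg
  exact (measureReal_eq_zero_iff).1 h0

/-! ### The stable law: density, reflection, distribution function -/

lemma stableCharFun_of_pos (α θ : ℝ) {t : ℝ} (ht : 0 < t) :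
    stableCharFun α θ t = Complex.exp
      (-Complex.exp ((-(Real.pi / 2 * α * θ) : ℝ) * Complex.I) * ((t ^ α : ℝ) : ℂ)) := by
  rw [stableCharFun, abs_of_pos ht, Real.sign_of_pos ht]
  rw [show -Complex.I * ((Real.pi / 2 * α * θ * 1 : ℝ) : ℂ) =
    (-(Real.pi / 2 * α * θ) : ℝ) * Complex.I by push_cast; ring]
  congr 1; ring

lemma norm_stableCharFun {α : ℝ} (hα : 0 < α) (θ t : ℝ) :
    ‖stableCharFun α θ t‖ = Real.exp (-Real.cos (Real.pi / 2 * α * θ) * |t| ^ α) := by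
  have hcos : |t| ^ α * Real.cos (-(Real.pi / 2 * α * θ * Real.sign t)) =
      |t| ^ α * Real.cos (Real.pi / 2 * α * θ) := by
    rcases lt_trichotomy t 0 with h | rfl | h
    · rw [Real.sign_of_neg h]; simp
    · simp [hα.ne']
    · rw [Real.sign_of_pos h]; simp
  rw [stableCharFun, Complex.norm_exp,
    show -Complex.I * ((Real.pi / 2 * α * θ * Real.sign t : ℝ) : ℂ) =
      (-(Real.pi / 2 * α * θ * Real.sign t) : ℝ) * Complex.I by push_cast; ring,
    ← Complex.ofReal_neg, Complex.re_ofReal_mul, Complex.exp_ofReal_mul_I_re, neg_mul, hcos]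
  congr 1; ring

lemma integrable_exp_neg_abs_rpow {α b : ℝ} (hα : 0 < α) (hb : 0 < b) :
    Integrable fun t : ℝ => Real.exp (-b * |t| ^ α) := by
  have h1 : IntegrableOn (fun t : ℝ => Real.exp (-b * |t| ^ α)) (Set.Ioi 0) :=
    (integrableOn_exp_neg_rpow hα hb).congr_fun
      (fun t ht => by simp only [abs_of_pos (Set.mem_Ioi.1 ht)]) measurableSet_Ioi
  have h2 : IntegrableOn (fun t : ℝ => Real.exp (-b * |t| ^ α)) (Set.Iic 0) := by
    rw [integrableOn_Iic_iff_integrableOn_Iio]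
    have := (show IntegrableOn (fun t : ℝ => Real.exp (-b * |t| ^ α)) (Set.Ioi (-0)) by
      simpa using h1).comp_neg_Iio
    simpa using this
  rw [← integrableOn_univ, ← Set.Iic_union_Ioi (a := (0 : ℝ))]
  exact h2.union h1

lemma integrable_charFun {α θ : ℝ} (hα : 0 < α) (hθ : |α * θ| < 1) {μ : Measure ℝ}
    (hμ : IsStandardStrictlyStable α θ μ) : Integrable (charFun μ) := by
  have := hμ.isProbabilityMeasure
  have hcos : 0 < Real.cos (Real.pi / 2 * α * θ) := by
    have h := abs_lt.1 hθ
    refine Real.cos_pos_of_mem_Ioo ⟨?_, ?_⟩ <;> nlinarith [Real.pi_pos]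
  refine (integrable_exp_neg_abs_rpow hα hcos).mono' measurable_charFun.aestronglyMeasurable
    (Eventually.of_forall fun t => ?_)
  rw [hμ.charFun_eq, norm_stableCharFun hα]

-- The integrand `g` satisfies `g (-t) = conj (g t)`, so the integral over the line is twice the
-- real part of that over the half-line. The factor `1 / (2 π)` comes from rescaling the frequency.
open scoped FourierTransform ComplexConjugate in
lemma pi_mul_re_fourier {α θ : ℝ} (hα : 0 < α) (hθ : |α * θ| < 1) {μ : Measure ℝ}
    (hμ : IsStandardStrictlyStable α θ μ) (x : ℝ) :
    Real.pi * (𝓕 (fun v : ℝ => charFun μ (2 * Real.pi * v)) x).re =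
      (stretchedLaplace α (Complex.exp ((-(Real.pi / 2 * α * θ) : ℝ) * Complex.I))
        (Complex.I * x)).re := by
  have hpi := Real.pi_pos
  set g : ℝ → ℂ := fun t => Complex.exp ((-(t * x) : ℝ) * Complex.I) * charFun μ t with hg
  have hgint : Integrable g := by
    refine (integrable_charFun hα hθ hμ).bdd_mul (c := 1) (by fun_prop)
      (Eventually.of_forall fun t => ?_)
    rw [Complex.norm_exp_ofReal_mul_I]
  have h1 : 𝓕 (fun v : ℝ => charFun μ (2 * Real.pi * v)) x = (2 * Real.pi)⁻¹ • ∫ t, g t := by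
    rw [Real.fourier_eq', ← abs_of_pos (inv_pos.2 (by positivity : 0 < 2 * Real.pi)),
      ← Measure.integral_comp_mul_left g (2 * Real.pi)]
    congr 1; ext v
    simp only [hg, smul_eq_mul, RCLike.inner_apply, conj_trivial]
    congr 3
    push_cast; ring
  have hneg : ∀ t, g (-t) = conj (g t) := by
    intro t
    simp only [hg, charFun_neg, map_mul, ← Complex.exp_conj, Complex.conj_ofReal, Complex.conj_I]
    congr 2; push_cast; ring
  have h2 : ∫ t in Set.Iic 0, g t = conj (∫ t in Set.Ioi 0, g t) := by
    rw [← integral_conj]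
    simp_rw [← hneg]
    rw [integral_comp_neg_Ioi, neg_zero]
  have h3 : ∫ t in Set.Ioi 0, g t =
      stretchedLaplace α (Complex.exp ((-(Real.pi / 2 * α * θ) : ℝ) * Complex.I))
        (Complex.I * x) := by
    refine setIntegral_congr_fun measurableSet_Ioi fun t ht => ?_
    simp only [hg]
    rw [hμ.charFun_eq, stableCharFun_of_pos α θ ht]
    congr 2; push_cast; ring
  rw [h1, ← intervalIntegral.integral_Iic_add_Ioi (b := 0) hgint.integrableOn hgint.integrableOn,
    h2, h3, Complex.smul_re, Complex.add_re, Complex.conj_re]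
  simp only [smul_eq_mul]
  field_simp
  ring

/-- Reflection of a strictly stable law. -/
lemma IsStandardStrictlyStable.map_neg {α θ : ℝ} {μ : Measure ℝ}
    (hμ : IsStandardStrictlyStable α θ μ) :
    IsStandardStrictlyStable α (-θ) (μ.map fun x => -x) := by
  have := hμ.isProbabilityMeasure
  refine ⟨Measure.isProbabilityMeasure_map measurable_neg.aemeasurable, fun t => ?_⟩
  have h := charFun_map_mul (μ := μ) (-1) t
  simp only [neg_mul, one_mul] at h
  rw [h, hμ.charFun_eq, stableCharFun, stableCharFun, abs_neg, Real.sign_neg]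
  congr 4; push_cast; ring

lemma cdf_of_pos {μ : Measure ℝ} [IsProbabilityMeasure μ] {x : ℝ} (hx : 0 < x) :
    ProbabilityTheory.cdf μ x =
      1 / 2 * (1 + Real.sign x) - Real.sign x * μ.real (Set.Ioi |x|) := by
  rw [ProbabilityTheory.cdf_eq_real, Real.sign_of_pos hx, abs_of_pos hx,
    ← Set.compl_Iic, measureReal_compl measurableSet_Iic, probReal_univ]
  ring

lemma cdf_of_neg {μ : Measure ℝ} [IsProbabilityMeasure μ] [NullSingletonClass μ] {x : ℝ}
    (hx : x < 0) : ProbabilityTheory.cdf μ x =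
      1 / 2 * (1 + Real.sign x) - Real.sign x * (μ.map fun x => -x).real (Set.Ioi |x|) := by
  rw [ProbabilityTheory.cdf_eq_real, Real.sign_of_neg hx, abs_of_neg hx,
    map_measureReal_apply measurable_neg measurableSet_Ioi]
  have : (fun x : ℝ => -x) ⁻¹' Set.Ioi (-x) = Set.Iio x := by ext z; simp
  rw [this, measureReal_congr (Iio_ae_eq_Iic (μ := μ) (a := x))]
  ring

/-! ### Tail expansions of the stable law -/

/-- Convergent tail expansions for `α ≤ 1`. -/
lemma hasSum_tail {α θ : ℝ} (hα : 0 < α) (hθ : |α * θ| < 1) {μ : Measure ℝ}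
    (hμ : IsStandardStrictlyStable α θ μ) {y : ℝ} (hy : 0 < y)
    (hcase : α < 1 ∨ α = 1 ∧ 1 < y) :
    HasSum (tailTerm y α θ) (Real.pi * μ.real (Set.Ioi y)) := by
  have := hμ.isProbabilityMeasure
  have hφ := (integrable_charFun hα hθ hμ).comp_mul_left' (R := 2 * Real.pi)
    (by have := Real.pi_pos; positivity)
  have hγ : |-(Real.pi / 2 * α * θ)| < Real.pi / 2 := by
    rw [abs_neg, mul_assoc, abs_mul, abs_of_pos (by have := Real.pi_pos; positivity)]
    nlinarith [Real.pi_pos]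
  have hc := exp_mul_I_re_pos hγ
  have hyα : 0 < y ^ (-α) := Real.rpow_pos_of_pos hy _
  have hG : Summable fun n : ℕ => Real.Gamma (α * n + 1) / (n ! : ℝ) * (y ^ (-α)) ^ n := by
    rcases hcase with h | ⟨rfl, h⟩
    · exact summable_gamma_div_factorial hα h one_pos hyα
    · have he : ∀ n : ℕ, Real.Gamma (1 * n + 1) / (n ! : ℝ) * (y ^ (-1 : ℝ)) ^ n = (y⁻¹) ^ n := by
        intro n
        rw [one_mul, Real.Gamma_nat_eq_factorial, div_self (by exact_mod_cast n.factorial_ne_zero),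
          one_mul, Real.rpow_neg_one]
      simp_rw [he]
      exact summable_geometric_of_lt_one (by positivity) (inv_lt_one_of_one_lt₀ h)
  obtain ⟨h1, h2⟩ := hasSum_tailTerm (θ := θ)
    (Complex.continuous_re.comp (continuous_fourier_charFun μ hφ)) hα hy hG (fun x hx => by
      have hx0 := hy.trans hx
      have hs : HasSum (laplaceTerm α
          (Complex.exp ((-(Real.pi / 2 * α * θ) : ℝ) * Complex.I)) (Complex.I * x))
          (stretchedLaplace α (Complex.exp ((-(Real.pi / 2 * α * θ) : ℝ) * Complex.I))
            (Complex.I * x)) := by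
        rcases hcase with h | ⟨rfl, h⟩
        · exact hasSum_stretchedLaplace hα h hc hx0
        · refine hasSum_stretchedLaplace_one hc ?_
          rw [Complex.norm_exp_ofReal_mul_I]
          exact h.trans hx
      have hs' := Complex.hasSum_re hs
      simp_rw [re_laplaceTerm α θ hx0] at hs'
      rw [Function.comp_apply, pi_mul_re_fourier hα hθ hμ]
      exact hs')
  rw [measureReal_Ioi_eq μ hφ h1]
  exact h2

/-- The asymptotic tail expansion for `1 < α`. -/
lemma exists_abs_tail_sub_le {α θ : ℝ} (hα : 1 < α) (hθ : |α * θ| < 1) {μ : Measure ℝ}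
    (hμ : IsStandardStrictlyStable α θ μ) {N : ℕ} (hN : 1 ≤ N) :
    ∃ C : ℝ, ∀ y : ℝ, 0 < y →
      |μ.real (Set.Ioi y) - tailPartialSum N y α θ| ≤ C * y ^ (-(α * N)) := by
  have := hμ.isProbabilityMeasure
  have hα0 : 0 < α := by linarith
  have hφ := (integrable_charFun hα0 hθ hμ).comp_mul_left' (R := 2 * Real.pi)
    (by have := Real.pi_pos; positivity)
  have hγ : |-(Real.pi / 2 * α * θ)| < Real.pi / 2 := by
    rw [abs_neg, mul_assoc, abs_mul, abs_of_pos (by have := Real.pi_pos; positivity)]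
    nlinarith [Real.pi_pos]
  obtain ⟨C, hC⟩ := exists_norm_stretchedLaplace_sub_le hα hγ N
  refine ⟨C / (Real.pi * (α * N)), fun y hy => ?_⟩
  obtain ⟨h1, h2⟩ := abs_integral_sub_tailPartialSum_le (θ := θ) (C := C)
    (Complex.continuous_re.comp (continuous_fourier_charFun μ hφ)) hα0 hN (fun x hx => by
      rw [Function.comp_apply, pi_mul_re_fourier hα0 hθ hμ]
      have h := (Complex.abs_re_le_norm _).trans (hC x hx)
      rw [Complex.sub_re, Complex.re_sum,
        Finset.sum_congr rfl fun n _ => re_laplaceTerm α θ hx n] at h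
      exact h) hy
  rw [measureReal_Ioi_eq μ hφ h1]
  exact h2

/-- Admissibility gives `α |θ| ≤ min (α, 2 - α)`, which is below `1` unless `α = 1`. -/
lemma Admissible.abs_mul_lt_one {α θ : ℝ} (h : Admissible α θ) (hne : α ≠ 1 ∨ |θ| ≠ 1) :
    |α * θ| < 1 := by
  have h0 := h.pos
  obtain ⟨h1, h2⟩ := le_min_iff.1 h.abs_le
  rw [abs_mul, abs_of_pos h0]
  have h3 : α * |θ| ≤ 2 - α := by
    calc α * |θ| ≤ α * (2 / α - 1) := by gcongr
      _ = 2 - α := by field_simp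
  rcases lt_trichotomy α 1 with h4 | h4 | h4
  · nlinarith [abs_nonneg θ]
  · subst h4
    have := lt_of_le_of_ne h1 (hne.resolve_left (by simp))
    linarith
  · linarith

/-- Reduction of the distribution function to the right tail of a strictly stable law. -/
lemma exists_cdf_eq_tail {α θ : ℝ} (hα : 0 < α) (hθ : |α * θ| < 1) {μ : Measure ℝ}
    (hμ : IsStandardStrictlyStable α θ μ) {x : ℝ} (hx : x ≠ 0) :
    ∃ ν : Measure ℝ, IsStandardStrictlyStable α (thetaStar θ x) ν ∧ |α * thetaStar θ x| < 1 ∧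
      ProbabilityTheory.cdf μ x =
        1 / 2 * (1 + Real.sign x) - Real.sign x * ν.real (Set.Ioi |x|) := by
  have := hμ.isProbabilityMeasure
  have := nullSingletonClass_of_integrable_charFun μ
    ((integrable_charFun hα hθ hμ).comp_mul_left' (R := 2 * Real.pi)
      (by have := Real.pi_pos; positivity))
  rcases lt_or_gt_of_ne hx with h | h
  · refine ⟨μ.map fun x => -x, ?_, ?_, cdf_of_neg h⟩
    · rw [thetaStar, Real.sign_of_neg h, mul_neg_one]; exact hμ.map_neg
    · rwa [thetaStar, Real.sign_of_neg h, mul_neg_one, mul_neg, abs_neg]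
  · refine ⟨μ, ?_, ?_, cdf_of_pos h⟩
    · rwa [thetaStar, Real.sign_of_pos h, mul_one]
    · rwa [thetaStar, Real.sign_of_pos h, mul_one]

lemma exists_tendsto_sum_tailTerm {α θ : ℝ} (hα : 0 < α) (hθ : |α * θ| < 1) {μ : Measure ℝ}
    (hμ : IsStandardStrictlyStable α θ μ) {x : ℝ} (hx : x ≠ 0) (hcase : α < 1 ∨ α = 1 ∧ 1 < |x|) :
    ∃ S : ℝ, Tendsto (fun N : ℕ => ∑ n ∈ Finset.Ico 1 N, tailTerm |x| α (thetaStar θ x) n) atTop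
        (𝓝 S) ∧
      ProbabilityTheory.cdf μ x = 1 / 2 * (1 + Real.sign x) - Real.sign x / Real.pi * S := by
  obtain ⟨ν, hν, hθ', h⟩ := exists_cdf_eq_tail hα hθ hμ hx
  have hs := (hasSum_tail hα hθ' hν (abs_pos.2 hx) hcase).tendsto_sum_nat
  simp_rw [sum_range_tailTerm] at hs
  refine ⟨_, hs, ?_⟩
  rw [h]
  have := Real.pi_ne_zero
  field_simp

/-! ### The degenerate case `α = 1`, `|θ| = 1` -/

/-- The inner exponential is `-i θ sign t`, so the exponent becomes the linear function `i θ t`. -/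
lemma eq_dirac_of_abs_eq_one {θ : ℝ} (hθ : |θ| = 1) {μ : Measure ℝ}
    (hμ : IsStandardStrictlyStable 1 θ μ) : μ = Measure.dirac θ := by
  have := hμ.isProbabilityMeasure
  refine Measure.ext_of_charFun (funext fun t => ?_)
  rw [hμ.charFun_eq, charFun_dirac, stableCharFun, Real.rpow_one]
  have hexp : Complex.exp (-Complex.I * ((Real.pi / 2 * 1 * θ * Real.sign t : ℝ) : ℂ)) =
      Complex.exp ((-(θ * Real.sign t * (Real.pi / 2)) : ℝ) * Complex.I) := by
    congr 1; push_cast; ring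
  have hI : Complex.exp (-(Real.pi / 2 * Complex.I)) = -Complex.I := by
    rw [Complex.exp_neg, Complex.exp_pi_div_two_mul_I, Complex.inv_I]
  rw [hexp]
  congr 1
  rcases lt_trichotomy t 0 with h | rfl | h
  · rw [Real.sign_of_neg h, abs_of_neg h]
    rcases eq_or_eq_neg_of_abs_eq hθ with rfl | rfl <;> simp [hI]
  · simp
  · rw [Real.sign_of_pos h, abs_of_pos h]
    rcases eq_or_eq_neg_of_abs_eq hθ with rfl | rfl <;> simp [hI]

/-- Every sine has argument `0` or `n π`, so `S = 0`; the distribution function of the point mass is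
constant on each side of `[-1, 1]`. -/
lemma exists_tendsto_sum_tailTerm_of_abs_eq_one {θ : ℝ} (hθ : |θ| = 1) {μ : Measure ℝ}
    (hμ : IsStandardStrictlyStable 1 θ μ) {x : ℝ} (hx : 1 < |x|) :
    ∃ S : ℝ, Tendsto (fun N : ℕ => ∑ n ∈ Finset.Ico 1 N, tailTerm |x| 1 (thetaStar θ x) n) atTop
        (𝓝 S) ∧
      ProbabilityTheory.cdf μ x = 1 / 2 * (1 + Real.sign x) - Real.sign x / Real.pi * S := by
  have hx0 : x ≠ 0 := by rintro rfl; simp at hx; linarith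
  have hstar : thetaStar θ x = 1 ∨ thetaStar θ x = -1 := by
    refine eq_or_eq_neg_of_abs_eq ?_
    rcases Real.sign_apply_eq_of_ne_zero x hx0 with h | h <;> simp [thetaStar, h, hθ]
  have hterm : ∀ n : ℕ, tailTerm |x| 1 (thetaStar θ x) n = 0 := by
    intro n
    have : Real.sin (Real.pi / 2 * 1 * n * (1 + thetaStar θ x)) = 0 := by
      rcases hstar with h | h
      · rw [h, show Real.pi / 2 * 1 * n * (1 + 1) = n * Real.pi by ring, Real.sin_nat_mul_pi]
      · simp [h]
    rw [tailTerm, this, mul_zero, zero_mul]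
  refine ⟨0, by simp [hterm], ?_⟩
  have hθ' : -1 ≤ θ ∧ θ ≤ 1 := abs_le.1 hθ.le
  rw [eq_dirac_of_abs_eq_one hθ hμ, ProbabilityTheory.cdf_eq_real,
    measureReal_def, Measure.dirac_apply' _ measurableSet_Iic]
  rcases lt_abs.1 hx with h | h
  · rw [Real.sign_of_pos (by linarith), Set.indicator_of_mem (by
      rw [Set.mem_Iic]; linarith)]
    norm_num
  · rw [Real.sign_of_neg (by linarith), Set.indicator_of_notMem (by
      rw [Set.mem_Iic]; linarith)]
    norm_num

lemma tailTerm_one {n : ℕ} (hn : 1 ≤ n) (x θ : ℝ) (hx : 0 ≤ x) : tailTerm x 1 θ n =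
    (-1) ^ (n + 1) / (n : ℝ) * Real.sin (Real.pi / 2 * n * (1 + θ)) * (x ^ n)⁻¹ := by
  obtain ⟨m, rfl⟩ : ∃ m, n = m + 1 := ⟨n - 1, by omega⟩
  have hm : (m ! : ℝ) ≠ 0 := by exact_mod_cast m.factorial_ne_zero
  rw [tailTerm, one_mul, mul_one, Real.rpow_neg hx, Real.rpow_natCast]
  have : Real.Gamma ((m + 1 : ℕ) : ℝ) = m ! := by
    push_cast; exact Real.Gamma_nat_eq_factorial m
  rw [this, Nat.factorial_succ]
  push_cast
  field_simp

end StrictlyStable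

theorem corollary1 (α θ : ℝ) (h : StrictlyStable.Admissible α θ) (μ : Measure ℝ)
    (hμ : StrictlyStable.IsStandardStrictlyStable α θ μ) :
    (α < 1 → ∀ x : ℝ, x ≠ 0 → ∃ S : ℝ,
      Tendsto (fun N : ℕ => ∑ n ∈ Finset.Ico 1 N,
          StrictlyStable.tailTerm |x| α (StrictlyStable.thetaStar θ x) n) atTop (𝓝 S) ∧
      ProbabilityTheory.cdf μ x =
        1 / 2 * (1 + Real.sign x) - Real.sign x / Real.pi * S) ∧
    (α = 1 → ∀ x : ℝ, 1 < |x| → ∃ S : ℝ,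
      Tendsto (fun N : ℕ => ∑ n ∈ Finset.Ico 1 N,
          StrictlyStable.tailTerm |x| α (StrictlyStable.thetaStar θ x) n) atTop (𝓝 S) ∧
      Tendsto (fun N : ℕ => ∑ n ∈ Finset.Ico 1 N,
          (-1) ^ (n + 1) / (n : ℝ) *
            Real.sin (Real.pi / 2 * n * (1 + StrictlyStable.thetaStar θ x)) *
            (|x| ^ n)⁻¹) atTop (𝓝 S) ∧
      ProbabilityTheory.cdf μ x =
        1 / 2 * (1 + Real.sign x) - Real.sign x / Real.pi * S) ∧
    (1 < α →
      (∀ x : ℝ, x ≠ 0 → StrictlyStable.thetaStar θ x ≠ 2 / α - 1 →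
        ¬ ∃ S : ℝ, Tendsto (fun N : ℕ => ∑ n ∈ Finset.Ico 1 N,
          StrictlyStable.tailTerm |x| α (StrictlyStable.thetaStar θ x) n) atTop (𝓝 S)) ∧
      (∀ N : ℕ, 1 ≤ N → ∀ l : Filter ℝ, l = atTop ∨ l = atBot →
        (fun x : ℝ => ProbabilityTheory.cdf μ x -
            (1 / 2 * (1 + Real.sign x) - Real.sign x *
              StrictlyStable.tailPartialSum N |x| α (StrictlyStable.thetaStar θ x)))
          =O[l] fun x : ℝ => |x| ^ (-(α * N)))) := by
  open StrictlyStable in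
  have hα := h.pos
  refine ⟨fun h1 x hx => ?_, fun h1 x hx => ?_, fun h1 => ⟨fun x hx hne => ?_, fun N hN l hl => ?_⟩⟩
  · exact exists_tendsto_sum_tailTerm hα (h.abs_mul_lt_one (Or.inl h1.ne)) hμ hx (Or.inl h1)
  · subst h1
    have hx0 : x ≠ 0 := by rintro rfl; simp at hx; linarith
    obtain ⟨S, hS, hcdf⟩ : ∃ S : ℝ, Tendsto (fun N : ℕ => ∑ n ∈ Finset.Ico 1 N,
          tailTerm |x| 1 (thetaStar θ x) n) atTop (𝓝 S) ∧
        ProbabilityTheory.cdf μ x = 1 / 2 * (1 + Real.sign x) - Real.sign x / Real.pi * S := by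
      by_cases hθ : |θ| = 1
      · exact exists_tendsto_sum_tailTerm_of_abs_eq_one hθ hμ hx
      · exact exists_tendsto_sum_tailTerm one_pos (h.abs_mul_lt_one (Or.inr hθ)) hμ hx0
          (Or.inr ⟨rfl, hx⟩)
    refine ⟨S, hS, hS.congr fun N => Finset.sum_congr rfl fun n hn => ?_, hcdf⟩
    exact tailTerm_one (Finset.mem_Ico.1 hn).1 _ _ (abs_nonneg x)
  · have habs : |thetaStar θ x| ≤ 2 / α - 1 := by
      refine le_trans (le_of_eq ?_) (le_min_iff.1 h.abs_le).2
      rcases Real.sign_apply_eq_of_ne_zero x hx with h | h <;> simp [thetaStar, h]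
    obtain ⟨hl, hu⟩ := abs_le.1 habs
    have hlt := lt_of_le_of_ne hu hne
    have e : α * (2 / α) = 2 := by field_simp
    -- With `β = α (1 + θ*) / 2`, the bound `θ* ≥ 1 - 2 / α` gives `β ≥ α - 1 > 0`, and `θ* < 2 / α
    -- - 1` gives `β < 1`.
    exact not_tendsto_sum_tailTerm h1 (abs_pos.2 hx) (by nlinarith [h.le_two]) (by nlinarith)
  · have hθ := h.abs_mul_lt_one (Or.inl h1.ne')
    have := hμ.isProbabilityMeasure
    have := nullSingletonClass_of_integrable_charFun μ
      ((integrable_charFun hα hθ hμ).comp_mul_left' (R := 2 * Real.pi)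
        (by have := Real.pi_pos; positivity))
    rcases hl with rfl | rfl
    · obtain ⟨C, hC⟩ := exists_abs_tail_sub_le h1 hθ hμ hN
      refine IsBigO.of_bound C ?_
      filter_upwards [eventually_gt_atTop 0] with x hx
      have hCx := hC |x| (abs_pos.2 hx.ne')
      -- For `x > 0` the tail enters the distribution function with a minus sign, hence the swap of
      -- the difference; for `x < 0` none is needed.
      rw [cdf_of_pos hx, thetaStar, Real.sign_of_pos hx, mul_one, Real.norm_eq_abs,
        Real.norm_of_nonneg (by positivity), abs_sub_comm]
      convert hCx using 2
      ring
    -- The expansion at `-∞` is the one at `+∞` for the reflected law.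
    · obtain ⟨C, hC⟩ := exists_abs_tail_sub_le h1 (by rwa [mul_neg, abs_neg]) hμ.map_neg hN
      refine IsBigO.of_bound C ?_
      filter_upwards [eventually_lt_atBot 0] with x hx
      have hCx := hC |x| (abs_pos.2 hx.ne)
      rw [cdf_of_neg hx, thetaStar, Real.sign_of_neg hx, mul_neg_one, Real.norm_eq_abs,
        Real.norm_of_nonneg (by positivity)]
      convert hCx using 2
      ring
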